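/- Let $n\ge 1$, let $H_0\in\mathbb C^{n\times n}$ be Hermitian and let $T\in(0,\infty]$ (with $1/\infty:=0$). Let $\mathcal L(\mathbb C^{n\times n})$ be the algebra of all linear maps on $\mathbb C^{n\times n}$. The set $\mathsf{TO}(H_0,T)\subset\mathcal L(\mathbb C^{n\times n})$ of thermal operations consists of all maps $$X\mapsto \operatorname{tr}_B\Big(U\Big(X\otimes\frac{e^{-H_B/T}}{\operatorname{tr}(e^{-H_B/T})}\Big)U^\dagger\Big),$$ where $m\ge1$, $H_B\in\mathbb C^{m\times m}$ is Hermitian and $U\in\mathbb C^{mn\times mn}$ is unitary with $U(H_0\otimes\mathbb 1+\mathbb 1\otimes H_B)U^\dagger=H_0\otimes\mathbb 1+\mathbb 1\otimes H_B$; here $\operatorname{tr}_B$ is the partial trace over the second factor. Let $\overline{\mathsf{TO}(H_0,T)}$ be its closure. For $X\in\mathbb C^{m\times m}$ and $B\in\mathbb C^{mn\times mn}$ let $\operatorname{tr}_X(B)\in\mathbb C^{n\times n}$ be the unique matrix such that $\operatorname{tr}(A\operatorname{tr}_X(B))=\operatorname{tr}((A\otimes X)B)$ for all $A\in\mathbb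 C^{n\times n}$. Let $m\ge1$, and let $H_B\in\mathbb C^{m\times m}$ and $H_{\mathsf{tot}}\in\mathbb C^{mn\times mn}$ be Hermitian with $[H_{\mathsf{tot}},H_0\otimes\mathbb 1+\mathbb 1\otimes H_B]=0$. Let $H_B=\sum_{j=1}^mE_j'|g_j\rangle\langle g_j|$ be any spectral decomposition ($E_j'\in\mathbb R$, $(g_j)_{j=1}^m$ an orthonormal basis of $\mathbb C^m$), let $H\in\mathbb C^{n\times n}$ be Hermitian with $[H,H_0]=0$, and put, for $j,k=1,\dots,m$, $$V_{jk}=e^{-E_k'/(2T)}\operatorname{tr}_{|g_k\rangle\langle g_j|}(H_{\mathsf{tot}}),\qquad \mathbf\Gamma_{B,\mathsf{tot}}=\sum_{j,k=1}^m\Big(\tfrac12\big(V_{jk}^\dagger V_{jk}(\cdot)+(\cdot)V_{jk}^\dagger V_{jk}\big)-V_{jk}(\cdot)V_{jk}^\dagger\Big).$$ Then the initial value problem $$\dot\Phi(t)=\big(-i[H,\,\cdot\,]-\mathbf\Gamma_{B,\mathsf{tot}}\big)\Phi(t)\quad(t\ge0),\qquad\Phi(0)=\operatorname{id},$$ has a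 unique solution $\Phi:[0,\infty)\to\mathcal L(\mathbb C^{n\times n})$. This solution is a continuous one-parameter semigroup, i.e. $\Phi$ is continuous, $\Phi(0)=\operatorname{id}$ and $\Phi(s+t)=\Phi(s)\Phi(t)$ for all $s,t\ge0$, and $\Phi(t)\in\overline{\mathsf{TO}(H_0,T)}$ for all $t\ge0$. Consequently, the generator $L=-i[H,\,\cdot\,]-\mathbf\Gamma_{B,\mathsf{tot}}$ lies in the Lie wedge of $\overline{\mathsf{TO}(H_0,T)}$, i.e. $e^{tL}\in\overline{\mathsf{TO}(H_0,T)}$ for all $t\ge0$. -/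

import Mathlib

open scoped Matrix Kronecker ENNReal

-- Matrices carry the spectral norm (operator norm on Euclidean space), superoperators the induced
-- operator norm; by finite-dimensionality all topologies involved are the usual ones.
open scoped Matrix.Norms.L2Operator

namespace ThermalOps

noncomputable section

/-- Complex `n × n` matrices. -/
abbrev Mat (n : ℕ) : Type := Matrix (Fin n) (Fin n) ℂ

/-- Matrices on the composite system `ℂⁿ ⊗ ℂᵐ` (system first, bath second). -/
abbrev Mat₂ (n m : ℕ) : Type := Matrix (Fin n × Fin m) (Fin n × Fin m) ℂ

/-- Linear maps on complex `n × n` matrices; multiplication is composition. -/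
abbrev SuperOp (n : ℕ) : Type := Mat n →L[ℂ] Mat n

/-- The partial trace `tr_X(B)` of `B` with respect to a matrix `X` on the bath. It is the unique
matrix with `tr(A tr_X(B)) = tr((A ⊗ X) B)` for all `A`, see `eq_partialTraceWith_iff`. -/
def partialTraceWith {n m : ℕ} (X : Mat m) (B : Mat₂ n m) : Mat n :=
  Matrix.of fun a b => ∑ i, ∑ j, X j i * B (a, i) (b, j)

/-- The partial trace over the bath. -/
def partialTrace {n m : ℕ} (B : Mat₂ n m) : Mat n := partialTraceWith 1 B

theorem trace_mul_partialTraceWith {n m : ℕ} (A : Mat n) (X : Mat m) (B : Mat₂ n m) :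
    (A * partialTraceWith X B).trace = ((A ⊗ₖ X) * B).trace := by
  simp only [Matrix.trace, Matrix.diag_apply, Matrix.mul_apply, partialTraceWith, Matrix.of_apply,
    Matrix.kroneckerMap_apply, Fintype.sum_prod_type, Finset.mul_sum]
  refine Finset.sum_congr rfl fun a _ => ?_
  rw [Finset.sum_comm (s := Finset.univ) (t := Finset.univ)
    (f := fun j b => ∑ i, A a b * X j i * B (b, i) (a, j))]
  refine Finset.sum_congr rfl fun b _ => ?_
  rw [Finset.sum_comm]
  refine Finset.sum_congr rfl fun j _ => Finset.sum_congr rfl fun i _ => ?_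
  ring

theorem eq_partialTraceWith_iff {n m : ℕ} (X : Mat m) (B : Mat₂ n m) (C : Mat n) :
    C = partialTraceWith X B ↔ ∀ A : Mat n, (A * C).trace = ((A ⊗ₖ X) * B).trace := by
  simp only [← trace_mul_partialTraceWith]
  exact Matrix.ext_iff_trace_mul_left

/-- The inverse temperature `1 / T` of `T ∈ (0, ∞]`, with `1 / ∞ = 0`. -/
def invTemp (T : ℝ≥0∞) : ℝ := (T⁻¹).toReal

/-- The Gibbs state `e^{-H_B/T} / tr(e^{-H_B/T})`. -/
def gibbsState {m : ℕ} (HB : Mat m) (T : ℝ≥0∞) : Mat m :=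
  (NormedSpace.exp (-(invTemp T : ℂ) • HB)).trace⁻¹ • NormedSpace.exp (-(invTemp T : ℂ) • HB)

/-- The Hamiltonian `H₀ ⊗ 1 + 1 ⊗ H_B` of the uncoupled composite system. -/
def freeHamiltonian {n m : ℕ} (H0 : Mat n) (HB : Mat m) : Mat₂ n m :=
  H0 ⊗ₖ (1 : Mat m) + (1 : Mat n) ⊗ₖ HB

/-- The set `TO(H₀, T)` of thermal operations: all maps
`X ↦ tr_B(U (X ⊗ e^{-H_B/T}/tr(e^{-H_B/T})) U†)` for a bath of some dimension `m ≥ 1` with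
Hamiltonian `H_B`, and a unitary `U` which preserves `H₀ ⊗ 1 + 1 ⊗ H_B`. -/
def thermalOperations {n : ℕ} (H0 : Mat n) (T : ℝ≥0∞) : Set (SuperOp n) :=
  {Φ | ∃ (m : ℕ) (HB : Mat m) (U : Mat₂ n m), 1 ≤ m ∧ HB.IsHermitian ∧
    U ∈ Matrix.unitaryGroup (Fin n × Fin m) ℂ ∧
    U * freeHamiltonian H0 HB * Uᴴ = freeHamiltonian H0 HB ∧
    ∀ X : Mat n, Φ X = partialTrace (U * (X ⊗ₖ gibbsState HB T) * Uᴴ)}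

/-- The commutator map `ad_H = [H, ·]`. -/
def adMap {n : ℕ} (H : Mat n) : SuperOp n :=
  LinearMap.toContinuousLinearMap
    (LinearMap.mulLeft ℂ H - LinearMap.mulRight ℂ H : Mat n →ₗ[ℂ] Mat n)

/-- `Γ_V = ½ (V†V (·) + (·) V†V) - V (·) V†`. -/
def dissipator {n : ℕ} (V : Mat n) : SuperOp n :=
  LinearMap.toContinuousLinearMap
    ((1 / 2 : ℂ) • (LinearMap.mulLeft ℂ (Vᴴ * V) + LinearMap.mulRight ℂ (Vᴴ * V))
      - LinearMap.mulLeft ℂ V ∘ₗ LinearMap.mulRight ℂ Vᴴ : Mat n →ₗ[ℂ] Mat n)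

theorem adMap_apply {n : ℕ} (H X : Mat n) : adMap H X = H * X - X * H := rfl

theorem dissipator_apply {n : ℕ} (V X : Mat n) :
    dissipator V X = (1 / 2 : ℂ) • (Vᴴ * V * X + X * (Vᴴ * V)) - V * X * Vᴴ := by
  simp [dissipator, mul_assoc]

/-- The matrix `|u⟩⟨v|`. -/
def ketBra {m : ℕ} (u v : EuclideanSpace ℂ (Fin m)) : Mat m :=
  Matrix.vecMulVec u.ofLp (star v.ofLp)

/-- `H = ∑ⱼ Eⱼ |gⱼ⟩⟨gⱼ|` is a spectral decomposition of `H`. -/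
def IsSpectralDecomposition {m : ℕ} (H : Mat m) (E : Fin m → ℝ)
    (g : OrthonormalBasis (Fin m) ℂ (EuclideanSpace ℂ (Fin m))) : Prop :=
  H = ∑ j, (E j : ℂ) • ketBra (g j) (g j)

/-- The Lindblad operators `V_{jk} = e^{-E_k/(2T)} tr_{|g_k⟩⟨g_j|}(H_tot)`. -/
def lindbladOp {n m : ℕ} (T : ℝ≥0∞) (E : Fin m → ℝ)
    (g : OrthonormalBasis (Fin m) ℂ (EuclideanSpace ℂ (Fin m))) (Htot : Mat₂ n m)
    (j k : Fin m) : Mat n :=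
  (Real.exp (-(E k * invTemp T / 2)) : ℂ) • partialTraceWith (ketBra (g k) (g j)) Htot

/-- `Γ_{B,tot} = ∑_{j,k} Γ_{V_{jk}}`. -/
def bathDissipator {n m : ℕ} (T : ℝ≥0∞) (E : Fin m → ℝ)
    (g : OrthonormalBasis (Fin m) ℂ (EuclideanSpace ℂ (Fin m))) (Htot : Mat₂ n m) : SuperOp n :=
  ∑ j, ∑ k, dissipator (lindbladOp T E g Htot j k)

/-- The generator `-i ad_H - Γ_{B,tot}`. -/
def markovGenerator {n m : ℕ} (T : ℝ≥0∞) (H : Mat n) (E : Fin m → ℝ)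
    (g : OrthonormalBasis (Fin m) ℂ (EuclideanSpace ℂ (Fin m))) (Htot : Mat₂ n m) : SuperOp n :=
  -(Complex.I • adMap H) - bathDissipator T E g Htot

/-- The Lie wedge `L(S)` of a subset (usually a closed semigroup) `S` of an algebra of operators:
all `A` such that `e^{tA} ∈ S` for all `t ≥ 0`. -/
def lieWedge {𝒜 : Type*} [NormedRing 𝒜] [NormedAlgebra ℝ 𝒜] (S : Set 𝒜) : Set 𝒜 :=
  {A | ∀ t : ℝ, 0 ≤ t → NormedSpace.exp (t • A) ∈ S}

/-- `Φ` solves `Φ'(t) = L Φ(t)` on `[0, ∞)`, with `Φ(0) = id`. -/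
def IsSolution {𝒜 : Type*} [NormedRing 𝒜] [NormedAlgebra ℝ 𝒜] (L : 𝒜) (Φ : ℝ → 𝒜) : Prop :=
  Φ 0 = 1 ∧ ∀ t : ℝ, 0 ≤ t → HasDerivWithinAt Φ (L * Φ t) (Set.Ici 0) t

/-- `(Φ(t))_{t ≥ 0}` is a continuous one-parameter semigroup. -/
def IsContinuousSemigroup {𝒜 : Type*} [NormedRing 𝒜] (Φ : ℝ → 𝒜) : Prop :=
  Φ 0 = 1 ∧ (∀ s t : ℝ, 0 ≤ s → 0 ≤ t → Φ (s + t) = Φ s * Φ t) ∧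
    ContinuousOn Φ (Set.Ici 0)

end

end ThermalOps

/-! # Markovian thermal operations generated by a bath coupling -/

namespace ThermalOps

open Filter Topology

/-! ### Product formulas and linear initial value problems in a Banach algebra. -/

section Banach

variable {𝒜 : Type*} [NormedRing 𝒜]

/-! The solution of the initial value problem is `e^{tL}`, so everything reduces to approximating
`e^{tL}` by thermal operations. Chernoff's formula `a_N ^ N → e^L` whenever `N (a_N - 1) → L`
(`tendsto_pow_exp`) allows the two summands of the generator to be treated separately, since the
thermal operations are closed under composition (`mul_mem_thermalOperations`).

The Hamiltonian part is exact: `e^{-itH/N}` acting on the system alone conserves energy. For the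
dissipator, couple to the bath through `e^{±A/√N}` with `A = -i√(tZ) H_tot`, where `Z` is the
partition function, and average over the sign. The terms of order `1/√N` cancel, and what remains at
order `1/N` is `½ tr_B [A,[A, X ⊗ ω]]` (`tendsto_randomSignChannel`). In the eigenbasis of `H_B`
this double commutator is `-t` times the dissipator (`second_order_eq_bathDissipator`,
`comp_second_order`). The average is again a thermal operation: a bath qubit with zero Hamiltonian
is maximally mixed at every temperature and can control the sign (`average_mem_thermalOperations`).
-/

theorem norm_pow_mul_le (a x : 𝒜) (N : ℕ) : ‖a ^ N * x‖ ≤ ‖a‖ ^ N * ‖x‖ := by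
  induction N with
  | zero => simp
  | succ N ih =>
    rw [pow_succ', mul_assoc, pow_succ', mul_assoc]
    exact (norm_mul_le _ _).trans (mul_le_mul_of_nonneg_left ih (norm_nonneg _))

/-- Telescoping, one factor at a time. Since `M ≥ 1`, the exponent `N` can replace the sharper `N -
1`. -/
theorem norm_pow_sub_pow_le {a b : 𝒜} {M : ℝ} (hM : 1 ≤ M) (ha : ‖a‖ ≤ M) (hb : ‖b‖ ≤ M) (N : ℕ) :
    ‖a ^ N - b ^ N‖ ≤ N * M ^ N * ‖a - b‖ := by
  induction N with
  | zero => simp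
  | succ N ih =>
    have h : a ^ (N + 1) - b ^ (N + 1) = a ^ N * (a - b) + (a ^ N - b ^ N) * b := by
      rw [pow_succ, pow_succ]; noncomm_ring
    have hM0 : 0 ≤ M := zero_le_one.trans hM
    have h1 : ‖a ^ N * (a - b)‖ ≤ M ^ (N + 1) * ‖a - b‖ :=
      (norm_pow_mul_le _ _ _).trans (mul_le_mul_of_nonneg_right
        ((pow_le_pow_left₀ (norm_nonneg _) ha N).trans (pow_le_pow_right₀ hM (Nat.le_succ N)))
        (norm_nonneg _))
    have h2 : ‖(a ^ N - b ^ N) * b‖ ≤ N * M ^ N * ‖a - b‖ * M :=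
      (norm_mul_le _ _).trans (mul_le_mul ih hb (norm_nonneg _) (by positivity))
    rw [h]
    refine (norm_add_le _ _).trans ((add_le_add h1 h2).trans (le_of_eq ?_))
    push_cast
    ring

variable [NormedAlgebra ℝ 𝒜]

/-- If `N • (a N - 1)` and `N • (b N - 1)` have the same limit then `a N ^ N - b N ^ N → 0`. -/
theorem tendsto_pow_sub_pow (h1 : ‖(1 : 𝒜)‖ ≤ 1) {a b : ℕ → 𝒜} {L : 𝒜}
    (ha : Tendsto (fun N : ℕ => (N : ℝ) • (a N - 1)) atTop (𝓝 L))
    (hb : Tendsto (fun N : ℕ => (N : ℝ) • (b N - 1)) atTop (𝓝 L)) :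
    Tendsto (fun N => a N ^ N - b N ^ N) atTop (𝓝 0) := by
  -- This form of the bound is chosen so that its `N`-th power is the constant `e^{‖L‖+1}`.
  have hbd : ∀ {c : ℕ → 𝒜}, Tendsto (fun N : ℕ => (N : ℝ) • (c N - 1)) atTop (𝓝 L) →
      ∀ᶠ N : ℕ in atTop, ‖c N‖ ≤ Real.exp ((‖L‖ + 1) / N) := by
    intro c hc
    filter_upwards [hc.norm.eventually_le_const (lt_add_one ‖L‖), eventually_gt_atTop 0]
      with N hN hN0
    have hN0' : (0 : ℝ) < N := by exact_mod_cast hN0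
    rw [norm_smul, Real.norm_of_nonneg hN0'.le] at hN
    have h2 : ‖c N - 1‖ ≤ (‖L‖ + 1) / N := by
      rw [le_div_iff₀ hN0']; linarith
    calc ‖c N‖ = ‖(c N - 1) + 1‖ := by rw [sub_add_cancel]
      _ ≤ (‖L‖ + 1) / N + 1 := (norm_add_le _ _).trans (add_le_add h2 h1)
      _ ≤ _ := Real.add_one_le_exp _
  have hlim : Tendsto (fun N : ℕ => Real.exp (‖L‖ + 1) * ‖(N : ℝ) • (a N - b N)‖) atTop (𝓝 0) := by
    have := ((ha.sub hb).norm).const_mul (Real.exp (‖L‖ + 1))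
    simpa [← smul_sub] using this
  refine squeeze_zero_norm' ?_ hlim
  filter_upwards [hbd ha, hbd hb, eventually_gt_atTop 0] with N hNa hNb hN0
  have hN0' : (0 : ℝ) < N := by exact_mod_cast hN0
  refine (norm_pow_sub_pow_le (Real.one_le_exp (by positivity)) hNa hNb N).trans (le_of_eq ?_)
  rw [norm_smul, Real.norm_of_nonneg hN0'.le, ← Real.exp_nat_mul, mul_div_cancel₀ _ hN0'.ne']
  ring

/-- From `ab - 1 = (a - 1) b + (b - 1)` and `b → 1`; no commutation is needed. Together with
Chernoff's formula this gives the Lie–Trotter formula. -/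
theorem tendsto_nsmul_mul_sub_one {a b : ℕ → 𝒜} {L M : 𝒜}
    (ha : Tendsto (fun N : ℕ => (N : ℝ) • (a N - 1)) atTop (𝓝 L))
    (hb : Tendsto (fun N : ℕ => (N : ℝ) • (b N - 1)) atTop (𝓝 M)) :
    Tendsto (fun N : ℕ => (N : ℝ) • (a N * b N - 1)) atTop (𝓝 (L + M)) := by
  have hb1 : Tendsto b atTop (𝓝 1) := by
    have h := (tendsto_inv_atTop_nhds_zero_nat (𝕜 := ℝ)).smul hb
    rw [zero_smul] at h
    have h' := h.add_const 1
    rw [zero_add] at h'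
    refine h'.congr' ?_
    filter_upwards [eventually_gt_atTop 0] with N hN
    have hN0' : (N : ℝ) ≠ 0 := by exact_mod_cast hN.ne'
    rw [smul_smul, inv_mul_cancel₀ hN0', one_smul, sub_add_cancel]
  have h := (ha.mul hb1).add hb
  rw [mul_one] at h
  refine h.congr fun N => ?_
  rw [smul_mul_assoc, ← smul_add]
  congr 1
  noncomm_ring

variable [CompleteSpace 𝒜]

theorem hasDerivAt_exp_smul (L : 𝒜) (t : ℝ) :
    HasDerivAt (fun t : ℝ => NormedSpace.exp (t • L)) (L * NormedSpace.exp (t • L)) t :=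
  hasDerivAt_exp_smul_const' L t

theorem tendsto_nsmul_exp_div_sub_one (L : 𝒜) :
    Tendsto (fun N : ℕ => (N : ℝ) • (NormedSpace.exp ((N : ℝ)⁻¹ • L) - 1)) atTop (𝓝 L) := by
  have h := (hasDerivAt_exp_smul L 0).tendsto_slope_zero
  simp only [zero_smul, NormedSpace.exp_zero, mul_one, zero_add] at h
  have h2 : Tendsto (fun N : ℕ => (N : ℝ)⁻¹) atTop (𝓝[≠] 0) := by
    refine tendsto_nhdsWithin_iff.2 ⟨tendsto_inv_atTop_nhds_zero_nat, ?_⟩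
    filter_upwards [eventually_gt_atTop 0] with N hN
    simpa using hN.ne'
  simpa [Function.comp_def] using h.comp h2

/-- **Chernoff's product formula** in a Banach algebra. -/
theorem tendsto_pow_exp (h1 : ‖(1 : 𝒜)‖ ≤ 1) {a : ℕ → 𝒜} {L : 𝒜}
    (ha : Tendsto (fun N : ℕ => (N : ℝ) • (a N - 1)) atTop (𝓝 L)) :
    Tendsto (fun N => a N ^ N) atTop (𝓝 (NormedSpace.exp L)) := by
  have h := (tendsto_pow_sub_pow h1 ha (tendsto_nsmul_exp_div_sub_one L)).add_const
    (NormedSpace.exp L)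
  rw [zero_add] at h
  refine h.congr' ?_
  filter_upwards [eventually_gt_atTop 0] with N hN
  let _ : NormedAlgebra ℚ 𝒜 := NormedAlgebra.restrictScalars ℚ ℝ 𝒜
  have hN0' : (N : ℝ) ≠ 0 := by exact_mod_cast hN.ne'
  rw [← NormedSpace.exp_nsmul, ← Nat.cast_smul_eq_nsmul ℝ, smul_smul, mul_inv_cancel₀ hN0',
    one_smul, sub_add_cancel]

theorem exp_smul_add_mem_closure (h1 : ‖(1 : 𝒜)‖ ≤ 1) {S : Set 𝒜}
    (hS : ∀ x ∈ S, ∀ y ∈ S, x * y ∈ S) {a b : ℕ → 𝒜} (haS : ∀ N, a N ∈ S) (hbS : ∀ N, b N ∈ S)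
    {t : ℝ} {L M : 𝒜} (ha : Tendsto (fun N : ℕ => (N : ℝ) • (a N - 1)) atTop (𝓝 (t • L)))
    (hb : Tendsto (fun N : ℕ => (N : ℝ) • (b N - 1)) atTop (𝓝 (t • M))) :
    NormedSpace.exp (t • (L + M)) ∈ closure S := by
  -- `S` is not assumed to contain `1`, so only positive powers are available; `N = 0` is discarded
  -- in the limit.
  have hpow : ∀ N k, (a N * b N) ^ (k + 1) ∈ S := by
    intro N k
    induction k with
    | zero => simpa using hS _ (haS N) _ (hbS N)
    | succ k ih => rw [pow_succ]; exact hS _ ih _ (hS _ (haS N) _ (hbS N))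
  rw [smul_add]
  refine mem_closure_of_tendsto (tendsto_pow_exp h1 (tendsto_nsmul_mul_sub_one ha hb)) ?_
  filter_upwards [eventually_gt_atTop 0] with N hN
  obtain ⟨k, rfl⟩ := Nat.exists_eq_succ_of_ne_zero hN.ne'
  exact hpow _ k

theorem exp_sub_quadratic_isBigO :
    (fun x : 𝒜 => NormedSpace.exp x - (1 + x + (1 / 2 : ℝ) • x ^ 2)) =O[𝓝 0]
      fun x => ‖x‖ ^ 3 := by
  have h := (NormedSpace.exp_hasFPowerSeriesAt_zero (𝕂 := ℝ) (𝔸 := 𝒜)).isBigO_sub_partialSum_pow 3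
  refine h.congr_left fun x => ?_
  simp [FormalMultilinearSeries.partialSum, Finset.sum_range_succ, NormedSpace.expSeries_apply_eq]

/-- Averaging over the sign removes the linear terms, which would diverge like `√N`. The quadratic
terms give the limit, and the cubic remainders contribute `N · N^{-3/2} → 0`. -/
theorem tendsto_nsmul_cosh_sub_one (D : 𝒜) :
    Tendsto (fun N : ℕ => (N : ℝ) • ((1 / 2 : ℝ) • (NormedSpace.exp ((√N)⁻¹ • D)
      + NormedSpace.exp (-((√N)⁻¹ • D))) - 1)) atTop (𝓝 ((1 / 2 : ℝ) • D ^ 2)) := by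
  have hs : Tendsto (fun N : ℕ => (√(N : ℝ))⁻¹) atTop (𝓝 0) :=
    (Real.tendsto_sqrt_atTop.comp tendsto_natCast_atTop_atTop).inv_tendsto_atTop
  have hx : Tendsto (fun N : ℕ => (√(N : ℝ))⁻¹ • D) atTop (𝓝 0) := by
    simpa using hs.smul_const D
  have hx' : Tendsto (fun N : ℕ => -((√(N : ℝ))⁻¹ • D)) atTop (𝓝 0) := by
    simpa using hx.neg
  have key : ∀ (x : ℕ → 𝒜), (∀ N, ‖x N‖ = (√(N : ℝ))⁻¹ * ‖D‖) → Tendsto x atTop (𝓝 0) →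
      Tendsto (fun N : ℕ => (N : ℝ) • (NormedSpace.exp (x N) - (1 + x N + (1 / 2 : ℝ) • x N ^ 2)))
        atTop (𝓝 0) := by
    intro x hxn hx0
    have h := (Asymptotics.isBigO_refl (fun N : ℕ => (N : ℝ)) atTop).smul
      (exp_sub_quadratic_isBigO.comp_tendsto hx0)
    refine h.trans_tendsto ?_
    have h3 : Tendsto (fun N : ℕ => (√(N : ℝ))⁻¹ * ‖D‖ ^ 3) atTop (𝓝 0) := by
      simpa using hs.mul_const (‖D‖ ^ 3)
    refine h3.congr' ?_
    filter_upwards [eventually_gt_atTop 0] with N hN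
    have hN0' : (0 : ℝ) < N := by exact_mod_cast hN
    have hsq : 0 < √(N : ℝ) := Real.sqrt_pos.2 hN0'
    simp only [Function.comp, hxn, smul_eq_mul]
    nth_rewrite 2 [← Real.sq_sqrt hN0'.le]
    field_simp
  have h := ((key _ (fun N => by rw [norm_smul, Real.norm_of_nonneg (by positivity)]) hx).add
    (key _ (fun N => by rw [norm_neg, norm_smul, Real.norm_of_nonneg (by positivity)])
      hx')).const_smul (1 / 2 : ℝ)
  have h' := h.add_const ((1 / 2 : ℝ) • D ^ 2)
  simp only [add_zero, smul_zero, zero_add] at h'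
  refine h'.congr' ?_
  filter_upwards [eventually_gt_atTop 0] with N hN
  have hN0' : (0 : ℝ) < N := by exact_mod_cast hN
  have hD : D ^ 2 = (N : ℝ) • ((√(N : ℝ))⁻¹ • D) ^ 2 := by
    rw [smul_pow, inv_pow, Real.sq_sqrt hN0'.le, smul_smul, mul_inv_cancel₀ hN0'.ne', one_smul]
  rw [hD, neg_sq]
  module

/-- The initial value problem `Φ' = L Φ`, `Φ(0) = 1` has the solution `e^{tL}`. -/
theorem isSolution_exp (L : 𝒜) : IsSolution L fun t => NormedSpace.exp (t • L) :=
  ⟨by simp, fun t _ => (hasDerivAt_exp_smul L t).hasDerivWithinAt⟩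

/-- The product `e^{-sL} Φ(s)` has zero derivative on `[0, ∞)`, hence keeps its initial value `1`.
-/
theorem IsSolution.eq_exp {L : 𝒜} {Φ : ℝ → 𝒜} (h : IsSolution L Φ) {t : ℝ} (ht : 0 ≤ t) :
    Φ t = NormedSpace.exp (t • L) := by
  let _ : NormedAlgebra ℚ 𝒜 := NormedAlgebra.restrictScalars ℚ ℝ 𝒜
  have hd : ∀ s ∈ Set.Ici (0 : ℝ),
      HasDerivWithinAt (fun s : ℝ => NormedSpace.exp (s • (-L)) * Φ s) 0 (Set.Ici 0) s := by
    intro s hs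
    have h1 := ((hasDerivAt_exp_smul_const (-L) s).hasDerivWithinAt (s := Set.Ici 0)).mul (h.2 s hs)
    refine h1.congr_deriv ?_
    noncomm_ring
  have hc : NormedSpace.exp (t • (-L)) * Φ t = 1 := by
    have h0 := (convex_Ici (0 : ℝ)).norm_image_sub_le_of_norm_hasDerivWithin_le (C := 0) hd
      (fun s _ => by simp) (Set.self_mem_Ici) ht
    have h1 := sub_eq_zero.1 (norm_le_zero_iff.1 (h0.trans (by simp)))
    simpa [h.1] using h1
  have hinv : NormedSpace.exp (t • L) * NormedSpace.exp (t • (-L)) = 1 := by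
    rw [← NormedSpace.exp_add_of_commute (by
      rw [smul_neg]; exact (Commute.refl _).neg_right), smul_neg, add_neg_cancel,
      NormedSpace.exp_zero]
  calc Φ t = NormedSpace.exp (t • L) * NormedSpace.exp (t • (-L)) * Φ t := by rw [hinv, one_mul]
    _ = _ := by rw [mul_assoc, hc, mul_one]

theorem IsSolution.isContinuousSemigroup {L : 𝒜} {Φ : ℝ → 𝒜} (h : IsSolution L Φ) :
    IsContinuousSemigroup Φ := by
  refine ⟨h.1, fun s t hs ht => ?_, fun t ht => (h.2 t ht).continuousWithinAt⟩
  let _ : NormedAlgebra ℚ 𝒜 := NormedAlgebra.restrictScalars ℚ ℝ 𝒜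
  rw [h.eq_exp hs, h.eq_exp ht, h.eq_exp (add_nonneg hs ht), add_smul,
    NormedSpace.exp_add_of_commute (((Commute.refl L).smul_left s).smul_right t)]

end Banach

/-! ### Partial traces and Gibbs states on tensor products. -/

noncomputable section Bath

variable {α ι κ : Type*} [Fintype α] [DecidableEq α] [Fintype ι] [DecidableEq ι]
  [Fintype κ] [DecidableEq κ]

/-- The partial trace over the second factor, for arbitrary index types. -/
def bathTrace {α ι : Type*} [Fintype ι] (M : Matrix (α × ι) (α × ι) ℂ) : Matrix α α ℂ :=
  Matrix.of fun a b => ∑ i, M (a, i) (b, i)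

theorem bathTrace_eq_partialTrace {n m : ℕ} (M : Mat₂ n m) : partialTrace M = bathTrace M := by
  ext a b
  simp [partialTrace, partialTraceWith, bathTrace, Matrix.one_apply]

theorem bathTrace_reindex {n : ℕ} (e : ι ≃ κ) (M : Matrix (Fin n × ι) (Fin n × ι) ℂ) :
    bathTrace (Matrix.reindexAlgEquiv ℂ ℂ ((Equiv.refl (Fin n)).prodCongr e) M) = bathTrace M := by
  ext a b
  simp only [bathTrace, Matrix.of_apply, Matrix.coe_reindexAlgEquiv, Matrix.reindex_apply,
    Matrix.submatrix_apply]
  exact Equiv.sum_comp e.symm fun i => M (a, i) (b, i)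

theorem bathTrace_kronecker {α ι : Type*} [Fintype ι] (X : Matrix α α ℂ) (Y : Matrix ι ι ℂ) :
    bathTrace (X ⊗ₖ Y) = Y.trace • X := by
  ext a b
  simp [bathTrace, Matrix.trace, ← Finset.mul_sum, mul_comm]

theorem bathTrace_kronecker_one_mul {α ι : Type*} [Fintype α] [Fintype ι] [DecidableEq ι]
    (A : Matrix α α ℂ) (M : Matrix (α × ι) (α × ι) ℂ) :
    bathTrace ((A ⊗ₖ (1 : Matrix ι ι ℂ)) * M) = A * bathTrace M := by
  ext a b
  simp only [bathTrace, Matrix.of_apply, Matrix.mul_apply, Matrix.kroneckerMap_apply,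
    Fintype.sum_prod_type, Matrix.one_apply, mul_ite, mul_one, mul_zero, ite_mul, zero_mul,
    Finset.sum_ite_eq, Finset.mem_univ, if_true, Finset.mul_sum]
  exact Finset.sum_comm

theorem bathTrace_mul_kronecker_one {α ι : Type*} [Fintype α] [Fintype ι] [DecidableEq ι]
    (A : Matrix α α ℂ) (M : Matrix (α × ι) (α × ι) ℂ) :
    bathTrace (M * (A ⊗ₖ (1 : Matrix ι ι ℂ))) = bathTrace M * A := by
  ext a b
  simp only [bathTrace, Matrix.of_apply, Matrix.mul_apply, Matrix.kroneckerMap_apply,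
    Fintype.sum_prod_type, Matrix.one_apply, mul_ite, mul_one, mul_zero,
    Finset.sum_ite_eq', Finset.mem_univ, if_true, Finset.sum_mul]
  exact Finset.sum_comm

/-- The Gibbs state at inverse temperature `β`, for arbitrary index types. -/
def gibbs (β : ℝ) (HB : Matrix ι ι ℂ) : Matrix ι ι ℂ :=
  (NormedSpace.exp (-(β : ℂ) • HB)).trace⁻¹ • NormedSpace.exp (-(β : ℂ) • HB)

theorem map_matrix_exp (f : Matrix ι ι ℂ →ₐ[ℂ] Matrix κ κ ℂ) (X : Matrix ι ι ℂ) :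
    f (NormedSpace.exp X) = NormedSpace.exp (f X) := by
  let _ : NormedAlgebra ℚ (Matrix ι ι ℂ) := NormedAlgebra.restrictScalars ℚ ℂ _
  let _ : NormedAlgebra ℚ (Matrix κ κ ℂ) := NormedAlgebra.restrictScalars ℚ ℂ _
  exact NormedSpace.map_exp f (f.toLinearMap.continuous_of_finiteDimensional) X

theorem gibbs_reindex (β : ℝ) (e : ι ≃ κ) (HB : Matrix ι ι ℂ) :
    gibbs β (Matrix.reindexAlgEquiv ℂ ℂ e HB) = Matrix.reindexAlgEquiv ℂ ℂ e (gibbs β HB) := by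
  have h : NormedSpace.exp (-(β : ℂ) • Matrix.reindexAlgEquiv ℂ ℂ e HB)
      = Matrix.reindexAlgEquiv ℂ ℂ e (NormedSpace.exp (-(β : ℂ) • HB)) := by
    rw [← map_smul]
    exact (map_matrix_exp (Matrix.reindexAlgEquiv ℂ ℂ e).toAlgHom _).symm
  have ht : ∀ M : Matrix ι ι ℂ, (Matrix.reindexAlgEquiv ℂ ℂ e M).trace = M.trace := fun M =>
    Equiv.sum_comp e.symm fun i => M i i
  rw [gibbs, gibbs, h, ht, map_smul]

/-- `A ↦ A ⊗ 1` as an algebra homomorphism. -/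
def kroneckerOneHom (α ι : Type*) [Fintype α] [DecidableEq α] [Fintype ι] [DecidableEq ι] :
    Matrix α α ℂ →ₐ[ℂ] Matrix (α × ι) (α × ι) ℂ :=
  AlgHom.ofLinearMap ((Matrix.kroneckerBilinear (R := ℂ) (α := ℂ)).flip 1) (by exact Matrix.one_kronecker_one) fun A B => by
      change (A * B) ⊗ₖ (1 : Matrix ι ι ℂ) = (A ⊗ₖ 1) * (B ⊗ₖ 1)
      rw [← Matrix.mul_kronecker_mul, one_mul]

/-- `B ↦ 1 ⊗ B` as an algebra homomorphism. -/
def oneKroneckerHom (α ι : Type*) [Fintype α] [DecidableEq α] [Fintype ι] [DecidableEq ι] :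
    Matrix ι ι ℂ →ₐ[ℂ] Matrix (α × ι) (α × ι) ℂ :=
  AlgHom.ofLinearMap (Matrix.kroneckerBilinear (R := ℂ) (α := ℂ) 1) (by exact Matrix.one_kronecker_one) fun A B => by
      change (1 : Matrix α α ℂ) ⊗ₖ (A * B) = (1 ⊗ₖ A) * (1 ⊗ₖ B)
      rw [← Matrix.mul_kronecker_mul, one_mul]

theorem exp_kronecker_one (A : Matrix α α ℂ) :
    NormedSpace.exp (A ⊗ₖ (1 : Matrix ι ι ℂ)) = NormedSpace.exp A ⊗ₖ (1 : Matrix ι ι ℂ) :=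
  (map_matrix_exp (kroneckerOneHom α ι) A).symm

theorem exp_one_kronecker (B : Matrix ι ι ℂ) :
    NormedSpace.exp ((1 : Matrix α α ℂ) ⊗ₖ B) = (1 : Matrix α α ℂ) ⊗ₖ NormedSpace.exp B :=
  (map_matrix_exp (oneKroneckerHom α ι) B).symm

theorem commute_kronecker_one_one_kronecker (A : Matrix α α ℂ) (B : Matrix ι ι ℂ) :
    Commute (A ⊗ₖ (1 : Matrix ι ι ℂ)) ((1 : Matrix α α ℂ) ⊗ₖ B) := by
  simp [Commute, SemiconjBy, ← Matrix.mul_kronecker_mul]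

/-- The two summands commute, so the exponential factorizes, and the trace is multiplicative. Thus
non-interacting baths form a single bath. -/
theorem gibbs_add (β : ℝ) (H₁ : Matrix ι ι ℂ) (H₂ : Matrix κ κ ℂ) :
    gibbs β (H₁ ⊗ₖ (1 : Matrix κ κ ℂ) + (1 : Matrix ι ι ℂ) ⊗ₖ H₂) = gibbs β H₁ ⊗ₖ gibbs β H₂ := by
  have h : NormedSpace.exp (-(β : ℂ) • (H₁ ⊗ₖ (1 : Matrix κ κ ℂ) + (1 : Matrix ι ι ℂ) ⊗ₖ H₂))
      = NormedSpace.exp (-(β : ℂ) • H₁) ⊗ₖ NormedSpace.exp (-(β : ℂ) • H₂) := by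
    rw [smul_add, ← Matrix.smul_kronecker, ← Matrix.kronecker_smul,
      Matrix.exp_add_of_commute _ _ (commute_kronecker_one_one_kronecker _ _), exp_kronecker_one,
      exp_one_kronecker, ← Matrix.mul_kronecker_mul, one_mul, mul_one]
  rw [gibbs, h, Matrix.trace_kronecker, gibbs, gibbs, Matrix.smul_kronecker, Matrix.kronecker_smul,
    smul_smul, mul_inv]

/-- This supplies unbiased random bits at any temperature. -/
theorem gibbs_zero (β : ℝ) : gibbs β (0 : Matrix ι ι ℂ) = (Fintype.card ι : ℂ)⁻¹ • 1 := by
  simp [gibbs]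

end Bath

/-! ### Composition and averaging of thermal operations. -/

noncomputable section ThermalSemigroup

variable {n : ℕ} {ι κ o J : Type*} [Fintype ι] [DecidableEq ι] [Fintype κ] [DecidableEq κ]
  [Fintype o] [DecidableEq o] [Fintype J] [DecidableEq J]

/-- The partial trace over the bath as a continuous linear map. -/
def bathTraceL (n : ℕ) (ι : Type*) [Fintype ι] [DecidableEq ι] :
    Matrix (Fin n × ι) (Fin n × ι) ℂ →L[ℂ] Mat n :=
  LinearMap.toContinuousLinearMap
    { toFun := bathTrace
      map_add' := fun M N => by ext a b; simp [bathTrace, Finset.sum_add_distrib]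
      map_smul' := fun c M => by ext a b; simp [bathTrace, Finset.mul_sum] }

/-- `X ↦ X ⊗ ω` as a continuous linear map. -/
def tensorStateL (n : ℕ) (ω : Matrix ι ι ℂ) : Mat n →L[ℂ] Matrix (Fin n × ι) (Fin n × ι) ℂ :=
  LinearMap.toContinuousLinearMap ((Matrix.kroneckerBilinear (R := ℂ) (α := ℂ)).flip ω)

/-- `X ↦ A X B` as a continuous linear map. -/
def sandwichL (A B : Matrix κ κ ℂ) : Matrix κ κ ℂ →L[ℂ] Matrix κ κ ℂ :=
  LinearMap.toContinuousLinearMap (LinearMap.mulLeft ℂ A ∘ₗ LinearMap.mulRight ℂ B)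

theorem bathTraceL_apply (M : Matrix (Fin n × ι) (Fin n × ι) ℂ) :
    bathTraceL n ι M = bathTrace M := rfl

theorem tensorStateL_apply (ω : Matrix ι ι ℂ) (X : Mat n) : tensorStateL n ω X = X ⊗ₖ ω := rfl

theorem sandwichL_apply (A B X : Matrix κ κ ℂ) : sandwichL A B X = A * X * B :=
  (mul_assoc _ _ _).symm

/-- The map `X ↦ tr_B(U (X ⊗ e^{-βH_B}/tr(e^{-βH_B})) U†)`. -/
def bathChannel (β : ℝ) (HB : Matrix ι ι ℂ) (U : Matrix (Fin n × ι) (Fin n × ι) ℂ) : SuperOp n :=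
  (bathTraceL n ι).comp ((sandwichL U Uᴴ).comp (tensorStateL n (gibbs β HB)))

theorem bathChannel_apply (β : ℝ) (HB : Matrix ι ι ℂ) (U : Matrix (Fin n × ι) (Fin n × ι) ℂ)
    (X : Mat n) : bathChannel β HB U X = bathTrace (U * (X ⊗ₖ gibbs β HB) * Uᴴ) := by
  simp only [bathChannel, ContinuousLinearMap.comp_apply, bathTraceL_apply, sandwichL_apply,
    tensorStateL_apply]

/-- `U` is a unitary that preserves `H₀ ⊗ 1 + 1 ⊗ H_B`, where `H_B` is Hermitian. -/
structure IsThermal (H0 : Mat n) (HB : Matrix ι ι ℂ) (U : Matrix (Fin n × ι) (Fin n × ι) ℂ) :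
    Prop where
  isHermitian : HB.IsHermitian
  unitary : U ∈ Matrix.unitaryGroup (Fin n × ι) ℂ
  commute : Commute U (H0 ⊗ₖ (1 : Matrix ι ι ℂ) + (1 : Mat n) ⊗ₖ HB)

theorem commute_iff_conj_eq {U F : Matrix κ κ ℂ} (hU : U ∈ Matrix.unitaryGroup κ ℂ) :
    Commute U F ↔ U * F * Uᴴ = F := by
  have h1 : U * Uᴴ = 1 := Matrix.mem_unitaryGroup_iff.1 hU
  have h2 : Uᴴ * U = 1 := Matrix.mem_unitaryGroup_iff'.1 hU
  constructor
  · intro h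
    rw [h.eq, mul_assoc, h1, mul_one]
  · intro h
    calc U * F = U * F * Uᴴ * U := by rw [mul_assoc _ Uᴴ, h2, mul_one]
      _ = F * U := by rw [h]

theorem reindexAlgEquiv_conjTranspose (e : κ ≃ J) (M : Matrix κ κ ℂ) :
    (Matrix.reindexAlgEquiv ℂ ℂ e M)ᴴ = Matrix.reindexAlgEquiv ℂ ℂ e Mᴴ := rfl

theorem reindexAlgEquiv_mem_unitaryGroup (e : κ ≃ J) {M : Matrix κ κ ℂ}
    (hM : M ∈ Matrix.unitaryGroup κ ℂ) :
    Matrix.reindexAlgEquiv ℂ ℂ e M ∈ Matrix.unitaryGroup J ℂ := by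
  rw [Matrix.mem_unitaryGroup_iff] at hM ⊢
  rw [Matrix.star_eq_conjTranspose] at hM ⊢
  rw [reindexAlgEquiv_conjTranspose, ← map_mul, hM, map_one]

theorem kronecker_one_mem_unitaryGroup {U : Matrix ι ι ℂ} (hU : U ∈ Matrix.unitaryGroup ι ℂ) :
    U ⊗ₖ (1 : Matrix κ κ ℂ) ∈ Matrix.unitaryGroup (ι × κ) ℂ := by
  rw [Matrix.mem_unitaryGroup_iff, Matrix.star_eq_conjTranspose] at hU ⊢
  rw [Matrix.conjTranspose_kronecker, ← Matrix.mul_kronecker_mul, hU, Matrix.conjTranspose_one,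
    one_mul, Matrix.one_kronecker_one]

theorem Commute.kronecker_one_add {U F : Matrix ι ι ℂ} (h : Commute U F) (K : Matrix κ κ ℂ) :
    Commute (U ⊗ₖ (1 : Matrix κ κ ℂ)) (F ⊗ₖ (1 : Matrix κ κ ℂ) + (1 : Matrix ι ι ℂ) ⊗ₖ K) := by
  refine Commute.add_right ?_ (commute_kronecker_one_one_kronecker _ _)
  rw [Commute, SemiconjBy, ← Matrix.mul_kronecker_mul, ← Matrix.mul_kronecker_mul, h.eq]

/-- Baths are built below on product index types; relabelling the bath changes neither the
conservation law nor the channel. -/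
theorem IsThermal.mem_thermalOperations [Nonempty ι] {H0 : Mat n} {HB : Matrix ι ι ℂ}
    {U : Matrix (Fin n × ι) (Fin n × ι) ℂ} (h : IsThermal H0 HB U) (T : ℝ≥0∞) :
    bathChannel (invTemp T) HB U ∈ thermalOperations H0 T := by
  let e := Fintype.equivFin ι
  let e' := (Equiv.refl (Fin n)).prodCongr e
  have hU := reindexAlgEquiv_mem_unitaryGroup e' h.unitary
  refine ⟨Fintype.card ι, Matrix.reindexAlgEquiv ℂ ℂ e HB, Matrix.reindexAlgEquiv ℂ ℂ e' U,
    Fintype.card_pos, ?_, hU, ?_, fun X => ?_⟩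
  · rw [Matrix.IsHermitian, reindexAlgEquiv_conjTranspose, h.isHermitian.eq]
  · rw [← commute_iff_conj_eq hU]
    have hF : freeHamiltonian H0 (Matrix.reindexAlgEquiv ℂ ℂ e HB)
        = Matrix.reindexAlgEquiv ℂ ℂ e' (H0 ⊗ₖ (1 : Matrix ι ι ℂ) + (1 : Mat n) ⊗ₖ HB) := by
      rw [freeHamiltonian, ← map_one (Matrix.reindexAlgEquiv ℂ ℂ e)]
      rfl
    rw [hF]
    exact h.commute.map _
  · have hg : gibbsState (Matrix.reindexAlgEquiv ℂ ℂ e HB) T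
        = Matrix.reindexAlgEquiv ℂ ℂ e (gibbs (invTemp T) HB) := gibbs_reindex _ _ _
    have hX : X ⊗ₖ Matrix.reindexAlgEquiv ℂ ℂ e (gibbs (invTemp T) HB)
        = Matrix.reindexAlgEquiv ℂ ℂ e' (X ⊗ₖ gibbs (invTemp T) HB) := rfl
    rw [hg, hX, reindexAlgEquiv_conjTranspose, ← map_mul, ← map_mul, bathTrace_eq_partialTrace,
      bathTrace_reindex, bathChannel_apply]

theorem exists_of_mem_thermalOperations {H0 : Mat n} {T : ℝ≥0∞} {Φ : SuperOp n}
    (h : Φ ∈ thermalOperations H0 T) : ∃ (m : ℕ) (HB : Mat m) (U : Mat₂ n m), 1 ≤ m ∧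
      IsThermal H0 HB U ∧ Φ = bathChannel (invTemp T) HB U := by
  obtain ⟨m, HB, U, hm, hHB, hU, hc, hΦ⟩ := h
  refine ⟨m, HB, U, hm, ⟨hHB, hU, (commute_iff_conj_eq hU).2 hc⟩, ?_⟩
  ext1 X
  rw [hΦ, bathChannel_apply, bathTrace_eq_partialTrace]
  rfl

/-- The equivalence which exchanges the last two of three factors. -/
def prodMidRight (α ι κ : Type*) : (α × κ) × ι ≃ α × (ι × κ) :=
  (Equiv.prodAssoc α κ ι).trans ((Equiv.refl α).prodCongr (Equiv.prodComm κ ι))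

/-- Grouping the system with one bath makes the other a spectator, so energy conservation for a
single coupling extends to the joint system. -/
theorem free_eq_reindex_prodAssoc (H0 : Mat n) (H₁ : Matrix ι ι ℂ) (H₂ : Matrix κ κ ℂ) :
    H0 ⊗ₖ (1 : Matrix (ι × κ) (ι × κ) ℂ)
        + (1 : Mat n) ⊗ₖ (H₁ ⊗ₖ (1 : Matrix κ κ ℂ) + (1 : Matrix ι ι ℂ) ⊗ₖ H₂)
      = Matrix.reindexAlgEquiv ℂ ℂ (Equiv.prodAssoc (Fin n) ι κ)
        ((H0 ⊗ₖ (1 : Matrix ι ι ℂ) + (1 : Mat n) ⊗ₖ H₁) ⊗ₖ (1 : Matrix κ κ ℂ)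
          + (1 : Matrix (Fin n × ι) (Fin n × ι) ℂ) ⊗ₖ H₂) := by
  ext ⟨a, i, k⟩ ⟨b, j, l⟩
  simp only [Matrix.coe_reindexAlgEquiv, Matrix.reindex_apply, Matrix.submatrix_apply,
    Matrix.add_apply, Matrix.kroneckerMap_apply, Matrix.one_apply, Prod.mk.injEq,
    Equiv.prodAssoc_symm_apply]
  split_ifs <;> simp_all <;> ring

theorem free_eq_reindex_prodRightComm (H0 : Mat n) (H₁ : Matrix ι ι ℂ) (H₂ : Matrix κ κ ℂ) :
    H0 ⊗ₖ (1 : Matrix (ι × κ) (ι × κ) ℂ)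
        + (1 : Mat n) ⊗ₖ (H₁ ⊗ₖ (1 : Matrix κ κ ℂ) + (1 : Matrix ι ι ℂ) ⊗ₖ H₂)
      = Matrix.reindexAlgEquiv ℂ ℂ (prodMidRight (Fin n) ι κ)
        ((H0 ⊗ₖ (1 : Matrix κ κ ℂ) + (1 : Mat n) ⊗ₖ H₂) ⊗ₖ (1 : Matrix ι ι ℂ)
          + (1 : Matrix (Fin n × κ) (Fin n × κ) ℂ) ⊗ₖ H₁) := by
  ext ⟨a, i, k⟩ ⟨b, j, l⟩
  simp only [prodMidRight, Matrix.coe_reindexAlgEquiv, Matrix.reindex_apply,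
    Matrix.submatrix_apply,
    Matrix.add_apply, Matrix.kroneckerMap_apply, Matrix.one_apply, Prod.mk.injEq,
    Equiv.symm_trans_apply, Equiv.prodAssoc_symm_apply, Equiv.prodCongr_symm,
    Equiv.prodCongr_apply, Prod.map, Equiv.refl_symm, Equiv.refl_apply, Equiv.prodComm_symm,
    Equiv.prodComm_apply, Prod.swap]
  split_ifs <;> simp_all <;> ring

theorem bathTrace_reindex_prodRightComm (M : Matrix ((Fin n × κ) × ι) ((Fin n × κ) × ι) ℂ) :
    bathTrace (Matrix.reindexAlgEquiv ℂ ℂ (prodMidRight (Fin n) ι κ) M)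
      = bathTrace (bathTrace M) := by
  ext a b
  exact Fintype.sum_prod_type_right _

/-- After the first interaction the second bath is still uncorrelated, so discarding the first bath
leaves a product. -/
theorem bathTrace_swap_kronecker (Y : Matrix (Fin n × ι) (Fin n × ι) ℂ) (ω : Matrix κ κ ℂ) :
    bathTrace ((Matrix.reindexAlgEquiv ℂ ℂ (prodMidRight (Fin n) ι κ)).symm
      (Matrix.reindexAlgEquiv ℂ ℂ (Equiv.prodAssoc (Fin n) ι κ) (Y ⊗ₖ ω))) = bathTrace Y ⊗ₖ ω := by
  ext ⟨a, k⟩ ⟨b, l⟩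
  simp only [bathTrace, Matrix.of_apply, Matrix.kroneckerMap_apply, Finset.sum_mul]
  rfl

/-- Two unitaries acting one after the other, each coupling the system to its own bath. -/
def seqUnitary (U₁ : Matrix (Fin n × ι) (Fin n × ι) ℂ) (U₂ : Matrix (Fin n × κ) (Fin n × κ) ℂ) :
    Matrix (Fin n × (ι × κ)) (Fin n × (ι × κ)) ℂ :=
  Matrix.reindexAlgEquiv ℂ ℂ (prodMidRight (Fin n) ι κ) (U₂ ⊗ₖ (1 : Matrix ι ι ℂ)) *
    Matrix.reindexAlgEquiv ℂ ℂ (Equiv.prodAssoc (Fin n) ι κ) (U₁ ⊗ₖ (1 : Matrix κ κ ℂ))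

theorem isHermitian_kronecker_sum {ι κ : Type*} [DecidableEq ι] [DecidableEq κ]
    {H₁ : Matrix ι ι ℂ} {H₂ : Matrix κ κ ℂ} (h₁ : H₁.IsHermitian)
    (h₂ : H₂.IsHermitian) :
    (H₁ ⊗ₖ (1 : Matrix κ κ ℂ) + (1 : Matrix ι ι ℂ) ⊗ₖ H₂).IsHermitian := by
  rw [Matrix.IsHermitian, Matrix.conjTranspose_add, Matrix.conjTranspose_kronecker,
    Matrix.conjTranspose_kronecker, h₁.eq, h₂.eq, Matrix.conjTranspose_one,
    Matrix.conjTranspose_one]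

theorem IsThermal.seqUnitary {H0 : Mat n} {H₁ : Matrix ι ι ℂ} {H₂ : Matrix κ κ ℂ}
    {U₁ : Matrix (Fin n × ι) (Fin n × ι) ℂ} {U₂ : Matrix (Fin n × κ) (Fin n × κ) ℂ}
    (h₁ : IsThermal H0 H₁ U₁) (h₂ : IsThermal H0 H₂ U₂) :
    IsThermal H0 (H₁ ⊗ₖ (1 : Matrix κ κ ℂ) + (1 : Matrix ι ι ℂ) ⊗ₖ H₂)
      (seqUnitary U₁ U₂) where
  isHermitian := isHermitian_kronecker_sum h₁.isHermitian h₂.isHermitian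
  unitary := mul_mem
    (reindexAlgEquiv_mem_unitaryGroup _ (kronecker_one_mem_unitaryGroup h₂.unitary))
    (reindexAlgEquiv_mem_unitaryGroup _ (kronecker_one_mem_unitaryGroup h₁.unitary))
  commute := by
    refine Commute.mul_left ?_ ?_
    · rw [free_eq_reindex_prodRightComm]
      exact (Commute.kronecker_one_add h₂.commute H₁).map _
    · rw [free_eq_reindex_prodAssoc]
      exact (Commute.kronecker_one_add h₁.commute H₂).map _

/-- The second unitary acts trivially on the first bath and can be pulled out of the partial trace
over it, as if that bath were discarded between the two interactions. -/
theorem bathChannel_seqUnitary (β : ℝ) (H₁ : Matrix ι ι ℂ) (H₂ : Matrix κ κ ℂ)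
    (U₁ : Matrix (Fin n × ι) (Fin n × ι) ℂ) (U₂ : Matrix (Fin n × κ) (Fin n × κ) ℂ) :
    bathChannel β (H₁ ⊗ₖ (1 : Matrix κ κ ℂ) + (1 : Matrix ι ι ℂ) ⊗ₖ H₂) (seqUnitary U₁ U₂)
      = bathChannel β H₂ U₂ * bathChannel β H₁ U₁ := by
  ext1 X
  rw [mul_apply_eq_comp, bathChannel_apply, bathChannel_apply, bathChannel_apply,
    gibbs_add]
  have hX : X ⊗ₖ (gibbs β H₁ ⊗ₖ gibbs β H₂)
      = Matrix.reindexAlgEquiv ℂ ℂ (Equiv.prodAssoc (Fin n) ι κ)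
        ((X ⊗ₖ gibbs β H₁) ⊗ₖ gibbs β H₂) := by
    ext ⟨a, i, k⟩ ⟨b, j, l⟩
    exact (mul_assoc _ _ _).symm
  set Y := U₁ * (X ⊗ₖ gibbs β H₁) * U₁ᴴ with hY
  have hY' : Matrix.reindexAlgEquiv ℂ ℂ (Equiv.prodAssoc (Fin n) ι κ)
        (U₁ ⊗ₖ (1 : Matrix κ κ ℂ)) * (X ⊗ₖ (gibbs β H₁ ⊗ₖ gibbs β H₂))
        * (Matrix.reindexAlgEquiv ℂ ℂ (Equiv.prodAssoc (Fin n) ι κ) (U₁ ⊗ₖ (1 : Matrix κ κ ℂ)))ᴴ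
      = Matrix.reindexAlgEquiv ℂ ℂ (Equiv.prodAssoc (Fin n) ι κ) (Y ⊗ₖ gibbs β H₂) := by
    rw [hX, reindexAlgEquiv_conjTranspose, ← map_mul, ← map_mul, Matrix.conjTranspose_kronecker,
      ← Matrix.mul_kronecker_mul, ← Matrix.mul_kronecker_mul, Matrix.conjTranspose_one, one_mul,
      mul_one]
  set R := Matrix.reindexAlgEquiv ℂ ℂ (prodMidRight (Fin n) ι κ) with hR
  have h : seqUnitary U₁ U₂ * (X ⊗ₖ (gibbs β H₁ ⊗ₖ gibbs β H₂)) * (seqUnitary U₁ U₂)ᴴ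
      = R ((U₂ ⊗ₖ (1 : Matrix ι ι ℂ)) * R.symm (Matrix.reindexAlgEquiv ℂ ℂ
        (Equiv.prodAssoc (Fin n) ι κ) (Y ⊗ₖ gibbs β H₂)) * (U₂ᴴ ⊗ₖ (1 : Matrix ι ι ℂ))) := by
    rw [map_mul, map_mul, AlgEquiv.apply_symm_apply, ← hY', seqUnitary, Matrix.conjTranspose_mul,
      reindexAlgEquiv_conjTranspose (prodMidRight (Fin n) ι κ), Matrix.conjTranspose_kronecker U₂,
      Matrix.conjTranspose_one]
    simp only [mul_assoc, hR]
  rw [h, bathTrace_reindex_prodRightComm, bathTrace_mul_kronecker_one,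
    bathTrace_kronecker_one_mul, bathTrace_swap_kronecker]

theorem mul_mem_thermalOperations {H0 : Mat n} {T : ℝ≥0∞} {Φ Ψ : SuperOp n}
    (hΦ : Φ ∈ thermalOperations H0 T) (hΨ : Ψ ∈ thermalOperations H0 T) :
    Φ * Ψ ∈ thermalOperations H0 T := by
  obtain ⟨m₂, H₂, U₂, hm₂, h₂, rfl⟩ := exists_of_mem_thermalOperations hΦ
  obtain ⟨m₁, H₁, U₁, hm₁, h₁, rfl⟩ := exists_of_mem_thermalOperations hΨ
  have : NeZero m₁ := ⟨by lia⟩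
  have : NeZero m₂ := ⟨by lia⟩
  rw [← bathChannel_seqUnitary]
  exact (h₁.seqUnitary h₂).mem_thermalOperations T

/-- A unitary on system and bath that is controlled by an additional bath register. -/
def controlledUnitary (U : o → Matrix (Fin n × ι) (Fin n × ι) ℂ) :
    Matrix (Fin n × (ι × o)) (Fin n × (ι × o)) ℂ :=
  Matrix.reindexAlgEquiv ℂ ℂ (Equiv.prodAssoc (Fin n) ι o) (Matrix.blockDiagonal U)

/-- With zero energy on the register, the total Hamiltonian is block diagonal with equal blocks, so
unitarity and conservation are checked blockwise. -/
theorem IsThermal.controlledUnitary {H0 : Mat n} {HB : Matrix ι ι ℂ}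
    {U : o → Matrix (Fin n × ι) (Fin n × ι) ℂ} (hHB : HB.IsHermitian)
    (h : ∀ b, IsThermal H0 HB (U b)) :
    IsThermal H0 (HB ⊗ₖ (1 : Matrix o o ℂ) + (1 : Matrix ι ι ℂ) ⊗ₖ (0 : Matrix o o ℂ))
      (controlledUnitary U) where
  isHermitian := isHermitian_kronecker_sum hHB Matrix.isHermitian_zero
  unitary := by
    refine reindexAlgEquiv_mem_unitaryGroup _ ?_
    rw [Matrix.mem_unitaryGroup_iff, Matrix.star_eq_conjTranspose,
      Matrix.blockDiagonal_conjTranspose, ← Matrix.blockDiagonal_mul, ← Matrix.blockDiagonal_one]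
    congr 1
    funext b
    exact Matrix.mem_unitaryGroup_iff.1 (h b).unitary
  commute := by
    rw [free_eq_reindex_prodAssoc, Matrix.kronecker_zero, add_zero, Matrix.kronecker_one]
    refine Commute.map (x := Matrix.blockDiagonal U) ?_
      (Matrix.reindexAlgEquiv ℂ ℂ (Equiv.prodAssoc (Fin n) ι o))
    rw [Commute, SemiconjBy, ← Matrix.blockDiagonal_mul, ← Matrix.blockDiagonal_mul]
    congr 1
    funext b
    exact (h b).commute

theorem bathTrace_reindex_blockDiagonal (M : o → Matrix (Fin n × ι) (Fin n × ι) ℂ) :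
    bathTrace (Matrix.reindexAlgEquiv ℂ ℂ (Equiv.prodAssoc (Fin n) ι o) (Matrix.blockDiagonal M))
      = ∑ b, bathTrace (M b) := by
  ext a b
  simp [bathTrace, Matrix.sum_apply, Fintype.sum_prod_type_right, Matrix.blockDiagonal_apply]

/-- The register is maximally mixed, and tracing it out sums the blocks with equal weights. -/
theorem bathChannel_controlledUnitary (β : ℝ) (HB : Matrix ι ι ℂ)
    (U : o → Matrix (Fin n × ι) (Fin n × ι) ℂ) :
    bathChannel β (HB ⊗ₖ (1 : Matrix o o ℂ) + (1 : Matrix ι ι ℂ) ⊗ₖ (0 : Matrix o o ℂ))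
      (controlledUnitary U) = (Fintype.card o : ℂ)⁻¹ • ∑ b, bathChannel β HB (U b) := by
  ext1 X
  have hX : X ⊗ₖ (gibbs β HB ⊗ₖ (1 : Matrix o o ℂ))
      = Matrix.reindexAlgEquiv ℂ ℂ (Equiv.prodAssoc (Fin n) ι o)
        (Matrix.blockDiagonal fun _ : o => X ⊗ₖ gibbs β HB) := by
    rw [← Matrix.kronecker_one]
    ext ⟨a, i, k⟩ ⟨b, j, l⟩
    exact (mul_assoc _ _ _).symm
  rw [bathChannel_apply, gibbs_add, gibbs_zero, Matrix.kronecker_smul, Matrix.kronecker_smul, hX,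
    controlledUnitary, reindexAlgEquiv_conjTranspose, mul_smul_comm, smul_mul_assoc, ← map_mul,
    ← map_mul, Matrix.blockDiagonal_conjTranspose, ← Matrix.blockDiagonal_mul,
    ← Matrix.blockDiagonal_mul, ← bathTraceL_apply, map_smul, bathTraceL_apply,
    bathTrace_reindex_blockDiagonal]
  simp [bathChannel_apply]

theorem average_mem_thermalOperations [Nonempty ι] [Nonempty o] {H0 : Mat n} {HB : Matrix ι ι ℂ}
    {U : o → Matrix (Fin n × ι) (Fin n × ι) ℂ} (hHB : HB.IsHermitian)
    (h : ∀ b, IsThermal H0 HB (U b)) (T : ℝ≥0∞) :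
    (Fintype.card o : ℂ)⁻¹ • ∑ b, bathChannel (invTemp T) HB (U b) ∈ thermalOperations H0 T := by
  rw [← bathChannel_controlledUnitary]
  exact (IsThermal.controlledUnitary hHB h).mem_thermalOperations T

end ThermalSemigroup

/-! ### Exponentials of commutator maps and the random-sign coupling. -/

noncomputable section Conjugation

variable {n : ℕ} {ι κ : Type*} [Fintype ι] [DecidableEq ι] [Fintype κ] [DecidableEq κ]

/-- The commutator map `[A, ·]` as a continuous linear map, for arbitrary index types. -/
def adL (A : Matrix κ κ ℂ) : Matrix κ κ ℂ →L[ℂ] Matrix κ κ ℂ :=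
  LinearMap.toContinuousLinearMap (LinearMap.mulLeft ℂ A - LinearMap.mulRight ℂ A)

theorem adL_apply (A X : Matrix κ κ ℂ) : adL A X = A * X - X * A := rfl

theorem adL_smul (c : ℂ) (A : Matrix κ κ ℂ) : adL (c • A) = c • adL A := by
  ext1 X
  simp [adL_apply, smul_sub]

/-- Left multiplication as a ring homomorphism into the continuous linear maps. -/
def mulLeftHom (R : Type*) [NormedRing R] [NormedAlgebra ℂ R] : R →+* (R →L[ℂ] R) where
  toFun := ContinuousLinearMap.mul ℂ R
  map_one' := by ext; simp
  map_mul' a b := by ext; simp [mul_assoc]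
  map_zero' := by simp
  map_add' := by simp

/-- Right multiplication as a ring homomorphism into the continuous linear maps. -/
def mulRightHom (R : Type*) [NormedRing R] [NormedAlgebra ℂ R] : Rᵐᵒᵖ →+* (R →L[ℂ] R) where
  toFun a := (ContinuousLinearMap.mul ℂ R).flip a.unop
  map_one' := by ext; simp
  map_mul' a b := by ext; simp [mul_assoc]
  map_zero' := by simp
  map_add' := by simp

/-- Left and right multiplications commute, and both are continuous ring homomorphisms (the right
one from the opposite ring), so the exponential passes through each. -/
theorem exp_mulLeft_sub_mulRight_apply {R : Type*} [NormedRing R] [NormedAlgebra ℂ R]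
    [CompleteSpace R] (A Y : R) :
    NormedSpace.exp (ContinuousLinearMap.mul ℂ R A - (ContinuousLinearMap.mul ℂ R).flip A) Y
      = NormedSpace.exp A * Y * NormedSpace.exp (-A) := by
  let _ : NormedAlgebra ℚ R := NormedAlgebra.restrictScalars ℚ ℂ _
  let _ : NormedAlgebra ℚ (R →L[ℂ] R) := NormedAlgebra.restrictScalars ℚ ℂ _
  have hl := NormedSpace.map_exp (mulLeftHom R) (ContinuousLinearMap.mul ℂ R).continuous A
  have hr := NormedSpace.map_exp (mulRightHom R)
    ((ContinuousLinearMap.mul ℂ R).flip.continuous.comp MulOpposite.continuous_unop)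
    (MulOpposite.op (-A))
  have hc : Commute (mulLeftHom R A) (mulRightHom R (MulOpposite.op (-A))) := by
    ext Z
    simp [mulLeftHom, mulRightHom, mul_assoc]
  have hs : ContinuousLinearMap.mul ℂ R A - (ContinuousLinearMap.mul ℂ R).flip A
      = mulLeftHom R A + mulRightHom R (MulOpposite.op (-A)) := by
    ext Z
    simp [mulLeftHom, mulRightHom, sub_eq_add_neg]
  rw [hs, NormedSpace.exp_add_of_commute hc, ← hl, ← hr, NormedSpace.exp_op]
  simp [mulLeftHom, mulRightHom, mul_assoc]

theorem exp_adL (A : Matrix κ κ ℂ) :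
    NormedSpace.exp (adL A) = sandwichL (NormedSpace.exp A) (NormedSpace.exp (-A)) := by
  ext1 Y
  rw [sandwichL_apply, ← exp_mulLeft_sub_mulRight_apply]
  rfl

theorem exp_mul_exp_neg (A : Matrix κ κ ℂ) :
    NormedSpace.exp A * NormedSpace.exp (-A) = 1 := by
  rw [← Matrix.exp_add_of_commute _ _ (Commute.refl A).neg_right, add_neg_cancel,
    NormedSpace.exp_zero]

theorem conjTranspose_exp_of_skew {A : Matrix κ κ ℂ} (hA : Aᴴ = -A) :
    (NormedSpace.exp A)ᴴ = NormedSpace.exp (-A) := by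
  rw [← Matrix.exp_conjTranspose, hA]

theorem exp_mem_unitaryGroup_of_skew {A : Matrix κ κ ℂ} (hA : Aᴴ = -A) :
    NormedSpace.exp A ∈ Matrix.unitaryGroup κ ℂ := by
  rw [Matrix.mem_unitaryGroup_iff, Matrix.star_eq_conjTranspose, conjTranspose_exp_of_skew hA,
    exp_mul_exp_neg]

theorem conjTranspose_I_smul {κ : Type*} {K : Matrix κ κ ℂ} (hK : K.IsHermitian) (s : ℝ) :
    (-(s * Complex.I) • K)ᴴ = -(-(s * Complex.I) • K) := by
  rw [Matrix.conjTranspose_smul, hK.eq]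
  simp

theorem isThermal_exp {H0 : Mat n} {HB : Matrix ι ι ℂ} {A : Matrix (Fin n × ι) (Fin n × ι) ℂ}
    (hHB : HB.IsHermitian) (hA : Aᴴ = -A)
    (hc : Commute A (H0 ⊗ₖ (1 : Matrix ι ι ℂ) + (1 : Mat n) ⊗ₖ HB)) :
    IsThermal H0 HB (NormedSpace.exp A) :=
  ⟨hHB, exp_mem_unitaryGroup_of_skew hA, hc.exp_left⟩

theorem bathChannel_exp (β : ℝ) (HB : Matrix ι ι ℂ) {A : Matrix (Fin n × ι) (Fin n × ι) ℂ}
    (hA : Aᴴ = -A) : bathChannel β HB (NormedSpace.exp A)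
      = (bathTraceL n ι).comp ((NormedSpace.exp (adL A)).comp (tensorStateL n (gibbs β HB))) := by
  rw [bathChannel, conjTranspose_exp_of_skew hA, exp_adL]

theorem isThermal_exp_kronecker_one {H0 : Mat n} {HB : Matrix ι ι ℂ} {A : Mat n}
    (hHB : HB.IsHermitian) (hA : Aᴴ = -A) (hc : Commute A H0) :
    IsThermal H0 HB (NormedSpace.exp A ⊗ₖ (1 : Matrix ι ι ℂ)) :=
  ⟨hHB, kronecker_one_mem_unitaryGroup (exp_mem_unitaryGroup_of_skew hA),
    Commute.kronecker_one_add hc.exp_left HB⟩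

theorem bathChannel_exp_kronecker_one (β : ℝ) {HB : Matrix ι ι ℂ} {A : Mat n}
    (hA : Aᴴ = -A) (htr : (gibbs β HB).trace = 1) :
    bathChannel β HB (NormedSpace.exp A ⊗ₖ (1 : Matrix ι ι ℂ)) = NormedSpace.exp (adL A) := by
  ext1 X
  rw [bathChannel_apply, Matrix.conjTranspose_kronecker, Matrix.conjTranspose_one,
    bathTrace_mul_kronecker_one, bathTrace_kronecker_one_mul, bathTrace_kronecker, htr, one_smul,
    exp_adL, sandwichL_apply, conjTranspose_exp_of_skew hA]

theorem bathTraceL_comp_tensorStateL {ω : Matrix ι ι ℂ} (htr : ω.trace = 1) :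
    (bathTraceL n ι).comp (tensorStateL n ω) = 1 := by
  ext1 X
  rw [ContinuousLinearMap.comp_apply, bathTraceL_apply, tensorStateL_apply, bathTrace_kronecker,
    htr, one_smul]
  rfl

/-- The thermal operations obtained from the bath coupling `± A / √N` with a random sign. -/
def randomSignChannel (β : ℝ) (HB : Matrix ι ι ℂ) (A : Matrix (Fin n × ι) (Fin n × ι) ℂ) (N : ℕ) :
    SuperOp n :=
  (Fintype.card Bool : ℂ)⁻¹ • ∑ b : Bool, bathChannel β HB
    (NormedSpace.exp ((if b then (1 : ℂ) else -1) • (((√(N : ℝ))⁻¹ : ℝ) : ℂ) • A))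

theorem skew_real_smul {κ : Type*} {A : Matrix κ κ ℂ} (hA : Aᴴ = -A) (s : ℝ) :
    ((s : ℂ) • A)ᴴ = -((s : ℂ) • A) := by
  rw [Matrix.conjTranspose_smul, hA]
  simp

theorem randomSignChannel_mem [Nonempty ι] {H0 : Mat n} {HB : Matrix ι ι ℂ}
    {A : Matrix (Fin n × ι) (Fin n × ι) ℂ} (hHB : HB.IsHermitian) (hA : Aᴴ = -A)
    (hc : Commute A (H0 ⊗ₖ (1 : Matrix ι ι ℂ) + (1 : Mat n) ⊗ₖ HB)) (T : ℝ≥0∞) (N : ℕ) :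
    randomSignChannel (invTemp T) HB A N ∈ thermalOperations H0 T := by
  refine average_mem_thermalOperations hHB (fun b => ?_) T
  refine isThermal_exp hHB ?_ ((hc.smul_left _).smul_left _)
  have h := skew_real_smul hA (√(N : ℝ))⁻¹
  cases b <;> simp_all

theorem randomSignChannel_eq (β : ℝ) (HB : Matrix ι ι ℂ) {A : Matrix (Fin n × ι) (Fin n × ι) ℂ}
    (hA : Aᴴ = -A) (N : ℕ) :
    randomSignChannel β HB A N = (bathTraceL n ι).comp (((1 / 2 : ℝ) •
      (NormedSpace.exp ((√(N : ℝ))⁻¹ • adL A) + NormedSpace.exp (-((√(N : ℝ))⁻¹ • adL A)))).comp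
        (tensorStateL n (gibbs β HB))) := by
  have hs := skew_real_smul hA (√(N : ℝ))⁻¹
  have h1 := bathChannel_exp β HB hs
  have h2 := bathChannel_exp β HB (A := (-1 : ℂ) • (((√(N : ℝ))⁻¹ : ℝ) : ℂ) • A) (by
    rw [neg_one_smul, Matrix.conjTranspose_neg, hs])
  have hD : adL ((((√(N : ℝ))⁻¹ : ℝ) : ℂ) • A) = (√(N : ℝ))⁻¹ • adL A :=
    (adL_smul _ _).trans (Complex.coe_smul (√(N : ℝ))⁻¹ (adL A))
  rw [hD] at h1
  rw [adL_smul, hD, neg_one_smul ℂ ((√(N : ℝ))⁻¹ • adL A)] at h2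
  rw [randomSignChannel, Fintype.sum_bool, if_pos rfl, if_neg Bool.false_ne_true, one_smul, h1, h2]
  have h3 : (Fintype.card Bool : ℂ)⁻¹ = ((1 / 2 : ℝ) : ℂ) := by simp
  ext1 X
  simp only [h3, ContinuousLinearMap.comp_apply, smul_apply, add_apply,
    ContinuousLinearMap.map_smul_of_tower, map_add, Complex.coe_smul]

theorem tendsto_randomSignChannel (β : ℝ) {HB : Matrix ι ι ℂ}
    {A : Matrix (Fin n × ι) (Fin n × ι) ℂ} (hA : Aᴴ = -A) (htr : (gibbs β HB).trace = 1) :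
    Tendsto (fun N : ℕ => (N : ℝ) • (randomSignChannel β HB A N - 1)) atTop
      (𝓝 ((bathTraceL n ι).comp (((1 / 2 : ℝ) • adL A ^ 2).comp (tensorStateL n (gibbs β HB))))) := by
  -- Compressing a joint superoperator to the system is linear, continuous and sends `1` to `1`
  -- because the bath state has trace one; the limit on the joint system therefore descends.
  have hcont : Continuous fun M : Matrix (Fin n × ι) (Fin n × ι) ℂ →L[ℂ]
      Matrix (Fin n × ι) (Fin n × ι) ℂ =>
      (bathTraceL n ι).comp (M.comp (tensorStateL n (gibbs β HB))) := by fun_prop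
  refine ((hcont.tendsto _).comp (tendsto_nsmul_cosh_sub_one (adL A))).congr fun N => ?_
  rw [randomSignChannel_eq β HB hA, Function.comp, ← bathTraceL_comp_tensorStateL htr]
  ext1 X
  simp only [ContinuousLinearMap.comp_apply, smul_apply, sub_apply,
    ContinuousLinearMap.map_smul_of_tower, map_sub, one_apply_eq_self]

end Conjugation

/-! ### The second-order term in the eigenbasis of the bath. -/

noncomputable section SecondOrder

variable {n m : ℕ}

/-- The block `⟨j| M |k⟩` of a matrix on the composite system. -/
def bathBlock (j k : Fin m) (M : Mat₂ n m) : Mat n := Matrix.of fun a b => M (a, j) (b, k)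

theorem bathBlock_mul (j k : Fin m) (M N : Mat₂ n m) :
    bathBlock j k (M * N) = ∑ l, bathBlock j l M * bathBlock l k N := by
  ext a b
  simp only [bathBlock, Matrix.of_apply, Matrix.mul_apply, Matrix.sum_apply,
    Fintype.sum_prod_type]
  exact Finset.sum_comm

theorem bathTrace_eq_sum_bathBlock (M : Mat₂ n m) : bathTrace M = ∑ j, bathBlock j j M := by
  ext a b
  simp [bathTrace, bathBlock, Matrix.sum_apply]

theorem bathBlock_kronecker_diagonal (j k : Fin m) (X : Mat n) (q : Fin m → ℂ) :
    bathBlock j k (X ⊗ₖ Matrix.diagonal q) = if j = k then q k • X else 0 := by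
  ext a b
  by_cases h : j = k
  · subst h
    simp [bathBlock, mul_comm]
  · simp [bathBlock, h]

theorem conjTranspose_bathBlock (j k : Fin m) {M : Mat₂ n m} (hM : M.IsHermitian) :
    (bathBlock j k M)ᴴ = bathBlock k j M := by
  ext a b
  exact hM.apply _ _

/-- Expand `K²Y + YK² - 2KYK` in bath blocks with `Y = X ⊗ diag q`. In the first two terms the
summations are swapped so that `k` always carries the weight. -/
theorem bathTrace_commutator_commutator_diagonal (K : Mat₂ n m) (X : Mat n) (q : Fin m → ℂ) :
    bathTrace (adL K (adL K (X ⊗ₖ Matrix.diagonal q))) = ∑ j, ∑ k, q k •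
      (bathBlock k j K * bathBlock j k K * X + X * (bathBlock k j K * bathBlock j k K)
        - (2 : ℂ) • (bathBlock j k K * X * bathBlock k j K)) := by
  have h : adL K (adL K (X ⊗ₖ Matrix.diagonal q)) = K * (K * (X ⊗ₖ Matrix.diagonal q))
      + (X ⊗ₖ Matrix.diagonal q) * K * K - (2 : ℂ) • (K * ((X ⊗ₖ Matrix.diagonal q) * K)) := by
    rw [adL_apply, adL_apply, two_smul]
    noncomm_ring
  have h1 : bathTrace (K * (K * (X ⊗ₖ Matrix.diagonal q)))
      = ∑ j, ∑ k, q k • (bathBlock k j K * bathBlock j k K * X) := by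
    rw [bathTrace_eq_sum_bathBlock, Finset.sum_comm]
    simp [bathBlock_mul, bathBlock_kronecker_diagonal, mul_assoc]
  have h2 : bathTrace ((X ⊗ₖ Matrix.diagonal q) * K * K)
      = ∑ j, ∑ k, q k • (X * (bathBlock k j K * bathBlock j k K)) := by
    rw [bathTrace_eq_sum_bathBlock, Finset.sum_comm]
    simp [mul_assoc, bathBlock_mul, bathBlock_kronecker_diagonal, Finset.mul_sum]
  have h3 : bathTrace (K * ((X ⊗ₖ Matrix.diagonal q) * K))
      = ∑ j, ∑ k, q k • (bathBlock j k K * X * bathBlock k j K) := by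
    rw [bathTrace_eq_sum_bathBlock]
    simp [bathBlock_mul, bathBlock_kronecker_diagonal, mul_assoc]
  rw [h, ← bathTraceL_apply, map_sub, map_add, map_smul, bathTraceL_apply, bathTraceL_apply,
    bathTraceL_apply, h1, h2, h3]
  simp only [Finset.smul_sum, ← Finset.sum_add_distrib, ← Finset.sum_sub_distrib]
  refine Finset.sum_congr rfl fun j _ => Finset.sum_congr rfl fun k _ => ?_
  module

/-- The unitary matrix whose columns are the vectors of an orthonormal basis. -/
def basisMatrix (g : OrthonormalBasis (Fin m) ℂ (EuclideanSpace ℂ (Fin m))) : Mat m :=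
  Matrix.of fun i k => g k i

variable (g : OrthonormalBasis (Fin m) ℂ (EuclideanSpace ℂ (Fin m)))

theorem conjTranspose_basisMatrix_mul : (basisMatrix g)ᴴ * basisMatrix g = 1 := by
  ext j k
  have h := orthonormal_iff_ite.1 g.orthonormal j k
  rw [PiLp.inner_apply] at h
  simpa [Matrix.mul_apply, basisMatrix, Matrix.one_apply, mul_comm] using h

theorem basisMatrix_mul_conjTranspose : basisMatrix g * (basisMatrix g)ᴴ = 1 :=
  mul_eq_one_comm.1 (conjTranspose_basisMatrix_mul g)

theorem sum_smul_ketBra (c : Fin m → ℂ) :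
    ∑ k, c k • ketBra (g k) (g k) = basisMatrix g * Matrix.diagonal c * (basisMatrix g)ᴴ := by
  ext i j
  rw [Matrix.mul_apply]
  simp only [Matrix.sum_apply, ketBra, Matrix.smul_apply, Matrix.vecMulVec_apply, basisMatrix,
    Matrix.mul_diagonal, Matrix.of_apply, Matrix.conjTranspose_apply,
    Pi.star_apply, smul_eq_mul]
  exact Finset.sum_congr rfl fun k _ => by ring

theorem exp_of_isSpectralDecomposition {HB : Mat m} {E : Fin m → ℝ}
    (h : IsSpectralDecomposition HB E g) (β : ℝ) :
    NormedSpace.exp (-(β : ℂ) • HB) = basisMatrix g *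
      Matrix.diagonal (fun k => (Real.exp (-(E k * β)) : ℂ)) * (basisMatrix g)ᴴ := by
  have hinv : (basisMatrix g)⁻¹ = (basisMatrix g)ᴴ :=
    Matrix.inv_eq_right_inv (basisMatrix_mul_conjTranspose g)
  have hunit : IsUnit (basisMatrix g) := IsUnit.of_mul_eq_one _ (basisMatrix_mul_conjTranspose g)
  have h1 : -(β : ℂ) • HB = basisMatrix g * Matrix.diagonal (fun k => -((E k * β : ℝ) : ℂ))
      * (basisMatrix g)⁻¹ := by
    rw [hinv, ← sum_smul_ketBra, h, Finset.smul_sum]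
    refine Finset.sum_congr rfl fun k _ => ?_
    rw [smul_smul]
    congr 1
    push_cast
    ring
  rw [h1, Matrix.exp_conj _ _ hunit, Matrix.exp_diagonal, hinv]
  congr 3
  let _ : NormedAlgebra ℚ ℂ := NormedAlgebra.restrictScalars ℚ ℂ ℂ
  funext k
  rw [Pi.coe_exp, ← Complex.exp_eq_exp_ℂ]
  push_cast
  rfl

theorem trace_exp_of_isSpectralDecomposition {HB : Mat m} {E : Fin m → ℝ}
    (h : IsSpectralDecomposition HB E g) (β : ℝ) :
    (NormedSpace.exp (-(β : ℂ) • HB)).trace = ((∑ k, Real.exp (-(E k * β)) : ℝ) : ℂ) := by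
  rw [exp_of_isSpectralDecomposition g h, Matrix.trace_mul_comm, ← mul_assoc,
    conjTranspose_basisMatrix_mul, one_mul, Matrix.trace_diagonal]
  push_cast
  rfl

/-- Both sides are the matrix element `⟨g_j| K |g_k⟩` over the bath. -/
theorem partialTraceWith_ketBra (K : Mat₂ n m) (j k : Fin m) :
    partialTraceWith (ketBra (g k) (g j)) K = bathBlock j k
      (((1 : Mat n) ⊗ₖ (basisMatrix g)ᴴ) * K * ((1 : Mat n) ⊗ₖ basisMatrix g)) := by
  ext a b
  simp only [partialTraceWith, bathBlock, ketBra, basisMatrix, Matrix.of_apply, Matrix.mul_apply,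
    Matrix.kroneckerMap_apply, Fintype.sum_prod_type, Matrix.one_apply, ite_mul, mul_ite, one_mul,
    zero_mul, mul_zero, Matrix.conjTranspose_apply, Matrix.vecMulVec_apply, Pi.star_apply]
  simp only [Finset.sum_ite_irrel, Finset.sum_const_zero, Finset.sum_ite_eq,
    Finset.sum_ite_eq', Finset.mem_univ, if_true, Finset.sum_mul]
  rw [Finset.sum_comm]
  exact Finset.sum_congr rfl fun i _ => Finset.sum_congr rfl fun l _ => by ring

/-- Tested against `A ⊗ 1`, which commutes with `1 ⊗ Gᴴ`, this is cyclicity of the full trace. -/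
theorem bathTrace_conj_one_kronecker {G : Mat m} (hG : Gᴴ * G = 1) (M : Mat₂ n m) :
    bathTrace (((1 : Mat n) ⊗ₖ G) * M * ((1 : Mat n) ⊗ₖ Gᴴ)) = bathTrace M := by
  have hc : ((1 : Mat n) ⊗ₖ Gᴴ) * ((1 : Mat n) ⊗ₖ G) = 1 := by
    rw [← Matrix.mul_kronecker_mul, hG, one_mul, Matrix.one_kronecker_one]
  rw [← bathTrace_eq_partialTrace, ← bathTrace_eq_partialTrace]
  refine ((eq_partialTraceWith_iff _ _ _).2 fun A => ?_).symm
  rw [partialTrace, trace_mul_partialTraceWith, ← mul_assoc, Matrix.trace_mul_comm _ (_ ⊗ₖ Gᴴ),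
    ← mul_assoc, ← mul_assoc, ← (commute_kronecker_one_one_kronecker A Gᴴ).eq,
    mul_assoc (A ⊗ₖ _), hc, mul_one]

theorem bathTrace_commutator_commutator {K : Mat₂ n m} (hK : K.IsHermitian) (X : Mat n)
    (q : Fin m → ℂ) :
    bathTrace (adL K (adL K (X ⊗ₖ (basisMatrix g * Matrix.diagonal q * (basisMatrix g)ᴴ)))) =
      ∑ j, ∑ k, (2 * q k) • dissipator (partialTraceWith (ketBra (g k) (g j)) K) X := by
  set W : Mat₂ n m := (1 : Mat n) ⊗ₖ basisMatrix g with hW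
  set W' : Mat₂ n m := (1 : Mat n) ⊗ₖ (basisMatrix g)ᴴ with hW'
  have h1 : W * W' = 1 := by
    rw [hW, hW', ← Matrix.mul_kronecker_mul, basisMatrix_mul_conjTranspose, one_mul,
      Matrix.one_kronecker_one]
  have h2 : W' * W = 1 := mul_eq_one_comm.1 h1
  set K' := W' * K * W with hK'
  have hWt : Wᴴ = W' := by rw [hW, Matrix.conjTranspose_kronecker, Matrix.conjTranspose_one]
  have hWt' : W'ᴴ = W := by rw [← hWt, Matrix.conjTranspose_conjTranspose]
  have hKh : K'.IsHermitian := by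
    rw [Matrix.IsHermitian, hK', Matrix.conjTranspose_mul, Matrix.conjTranspose_mul, hK.eq, hWt,
      hWt', mul_assoc]
  have hKK : K = W * K' * W' := by
    calc K = (W * W') * K * (W * W') := by rw [h1, one_mul, mul_one]
      _ = _ := by rw [hK']; simp only [mul_assoc]
  have hX : X ⊗ₖ (basisMatrix g * Matrix.diagonal q * (basisMatrix g)ᴴ)
      = W * (X ⊗ₖ Matrix.diagonal q) * W' := by
    rw [hW, hW', ← Matrix.mul_kronecker_mul, ← Matrix.mul_kronecker_mul, one_mul, mul_one]
  have hconj : ∀ A B : Mat₂ n m, (W * A * W') * (W * B * W') = W * (A * B) * W' := fun A B => by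
    calc (W * A * W') * (W * B * W') = W * A * (W' * W) * B * W' := by simp only [mul_assoc]
      _ = _ := by rw [h2, mul_one, mul_assoc W]
  have hcomm : ∀ A B : Mat₂ n m, adL (W * A * W') (W * B * W') = W * adL A B * W' := fun A B => by
    rw [adL_apply, adL_apply, hconj, hconj, mul_sub, sub_mul]
  rw [hX, hKK, hcomm, hcomm, hW, hW',
    bathTrace_conj_one_kronecker (conjTranspose_basisMatrix_mul g), ← hW, ← hW',
    bathTrace_commutator_commutator_diagonal, ← hKK]
  refine Finset.sum_congr rfl fun j _ => Finset.sum_congr rfl fun k _ => ?_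
  -- Hermiticity turns the `(k, j)` block into the adjoint of the `(j, k)` block, giving Lindblad
  -- form.
  rw [partialTraceWith_ketBra, ← hW, ← hW', ← hK', dissipator_apply, conjTranspose_bathBlock _ _ hKh]
  module

theorem dissipator_real_smul (r : ℝ) (V : Mat n) :
    dissipator ((r : ℂ) • V) = ((r ^ 2 : ℝ) : ℂ) • dissipator V := by
  ext1 X
  simp only [smul_apply, dissipator_apply, Matrix.conjTranspose_smul, Complex.star_def,
    Complex.conj_ofReal, smul_mul_assoc, mul_smul_comm]
  push_cast
  module

/-- The second-order term of the coupling to a thermal bath. -/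
theorem second_order_eq_bathDissipator {T : ℝ≥0∞} {E : Fin m → ℝ} {HB : Mat m} {K : Mat₂ n m}
    (hE : IsSpectralDecomposition HB E g) (hK : K.IsHermitian) :
    (bathTraceL n (Fin m)).comp (((1 / 2 : ℂ) • adL K ^ 2).comp
      (tensorStateL n (NormedSpace.exp (-(invTemp T : ℂ) • HB)))) = bathDissipator T E g K := by
  ext1 X
  simp only [ContinuousLinearMap.comp_apply, smul_apply, pow_two, mul_apply_eq_comp, map_smul,
    bathTraceL_apply, tensorStateL_apply]
  rw [exp_of_isSpectralDecomposition g hE, bathTrace_commutator_commutator g hK, bathDissipator]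
  simp only [Finset.smul_sum, sum_apply, lindbladOp]
  refine Finset.sum_congr rfl fun j _ => Finset.sum_congr rfl fun k _ => ?_
  -- The dissipator is quadratic in `V`, so the half exponents `e^{-E_k/(2T)}` square to full
  -- Boltzmann weights.
  rw [dissipator_real_smul, smul_apply, smul_smul, ← Real.exp_nat_mul]
  congr 1
  push_cast
  ring_nf

end SecondOrder

/-! ### Assembling the approximation of the semigroup. -/

noncomputable section Main

variable {n m : ℕ}

theorem adL_I_smul (s : ℝ) (H : Mat n) :
    adL (-(s * Complex.I) • H) = s • -(Complex.I • adMap H) := by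
  ext1 X
  rw [adL_smul]
  simp only [smul_apply, neg_apply, smul_neg, neg_smul, mul_smul, Complex.coe_smul]
  rfl

theorem half_adL_I_smul_sq {s : ℝ} (hs : 0 ≤ s) {κ : Type*} [Fintype κ] [DecidableEq κ]
    (K : Matrix κ κ ℂ) :
    (1 / 2 : ℝ) • adL (-((√s : ℝ) * Complex.I) • K) ^ 2 = -(s : ℂ) • ((1 / 2 : ℂ) • adL K ^ 2) := by
  have h : (-((√s : ℝ) * Complex.I)) ^ 2 = -(s : ℂ) := by
    rw [neg_sq, mul_pow, Complex.I_sq, ← Complex.ofReal_pow, Real.sq_sqrt hs, mul_neg_one]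
  ext1 X
  rw [pow_two] at h
  simp only [smul_apply, adL_smul, pow_two, mul_apply_eq_comp, map_smul]
  rw [smul_smul _ _ (adL K (adL K X)), h, smul_comm (-(s : ℂ)), ← Complex.coe_smul]
  congr 1
  norm_num

/-- The Lindblad operators carry unnormalized Boltzmann weights: the `Z` in the coupling strength
cancels the `1/Z` of the Gibbs state, and `(-i)² = -1` gives the sign. -/
theorem comp_second_order {T : ℝ≥0∞} {E : Fin m → ℝ} {HB : Mat m} {K : Mat₂ n m}
    {g : OrthonormalBasis (Fin m) ℂ (EuclideanSpace ℂ (Fin m))}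
    (hE : IsSpectralDecomposition HB E g) (hK : K.IsHermitian) {t Z : ℝ} (ht : 0 ≤ t) (hZ : 0 < Z)
    (hgibbs : gibbs (invTemp T) HB = (Z : ℂ)⁻¹ • NormedSpace.exp (-(invTemp T : ℂ) • HB)) :
    (bathTraceL n (Fin m)).comp
      (((1 / 2 : ℝ) • adL (-((√(t * Z) : ℝ) * Complex.I) • K) ^ 2).comp
        (tensorStateL n (gibbs (invTemp T) HB))) = t • -bathDissipator T E g K := by
  have hZ0 : (Z : ℂ) ≠ 0 := by exact_mod_cast hZ.ne'
  have hst : ∀ (c : ℂ) (ω : Mat m), tensorStateL n (c • ω) = c • tensorStateL n ω := fun c ω => by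
    ext1 X
    exact Matrix.kronecker_smul _ _ _
  have hc : -((t * Z : ℝ) : ℂ) * (Z : ℂ)⁻¹ = -(t : ℂ) := by
    push_cast
    field_simp
  rw [half_adL_I_smul_sq (mul_nonneg ht hZ.le), hgibbs, hst, ContinuousLinearMap.smul_comp,
    ContinuousLinearMap.comp_smul, ContinuousLinearMap.comp_smul, ContinuousLinearMap.comp_smul,
    second_order_eq_bathDissipator g hE hK, smul_smul, hc]
  ext1 X
  simp only [smul_apply, neg_apply, smul_neg, neg_smul, Complex.coe_smul]

theorem exp_markovGenerator_mem (hm : 1 ≤ m) (T : ℝ≥0∞) {H0 : Mat n}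
    {HB : Mat m} (hHB : HB.IsHermitian) {Htot : Mat₂ n m} (hHtot : Htot.IsHermitian)
    (hcomm : Commute Htot (freeHamiltonian H0 HB)) {E : Fin m → ℝ}
    {g : OrthonormalBasis (Fin m) ℂ (EuclideanSpace ℂ (Fin m))}
    (hEg : IsSpectralDecomposition HB E g) {H : Mat n} (hH : H.IsHermitian) (hHH0 : Commute H H0)
    {t : ℝ} (ht : 0 ≤ t) :
    NormedSpace.exp (t • markovGenerator T H E g Htot) ∈ closure (thermalOperations H0 T) := by
  have : NeZero m := ⟨by lia⟩
  set β := invTemp T with hβ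
  set Z : ℝ := ∑ k, Real.exp (-(E k * β)) with hZ
  have hZpos : 0 < Z := Finset.sum_pos (fun k _ => Real.exp_pos _) Finset.univ_nonempty
  have htrE : (NormedSpace.exp (-(β : ℂ) • HB)).trace = (Z : ℂ) :=
    trace_exp_of_isSpectralDecomposition g hEg β
  have hZ0 : (Z : ℂ) ≠ 0 := by exact_mod_cast hZpos.ne'
  have hgibbs : gibbs β HB = (Z : ℂ)⁻¹ • NormedSpace.exp (-(β : ℂ) • HB) := by rw [gibbs, htrE]
  have htr : (gibbs β HB).trace = 1 := by
    rw [hgibbs, Matrix.trace_smul, htrE, smul_eq_mul, inv_mul_cancel₀ hZ0]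
  set A : Mat₂ n m := -((√(t * Z) : ℝ) * Complex.I) • Htot with hA
  have hAskew : Aᴴ = -A := conjTranspose_I_smul hHtot _
  have hAcomm : Commute A (freeHamiltonian H0 HB) := hcomm.smul_left _
  set B : ℕ → Mat n := fun N => -(((N : ℝ)⁻¹ * t : ℝ) * Complex.I) • H with hB
  have hBskew : ∀ N, (B N)ᴴ = -B N := fun N => conjTranspose_I_smul hH _
  have hunit : Tendsto (fun N : ℕ => (N : ℝ) •
      (bathChannel β HB (NormedSpace.exp (B N) ⊗ₖ (1 : Mat m)) - 1)) atTop
      (𝓝 (t • -(Complex.I • adMap H))) := by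
    refine (tendsto_nsmul_exp_div_sub_one (t • -(Complex.I • adMap H))).congr fun N => ?_
    rw [bathChannel_exp_kronecker_one β (hBskew N) htr]
    rw [adL_I_smul, mul_smul]
  have hsign := tendsto_randomSignChannel β hAskew htr
  have hdiss : (bathTraceL n (Fin m)).comp (((1 / 2 : ℝ) • adL A ^ 2).comp
      (tensorStateL n (gibbs β HB))) = t • -bathDissipator T E g Htot :=
    comp_second_order hEg hHtot ht hZpos hgibbs
  rw [hdiss] at hsign
  rw [markovGenerator, sub_eq_add_neg]
  -- Only `‖1‖ ≤ 1` is used, since `n = 0` is allowed and the operator algebra is then trivial.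
  exact exp_smul_add_mem_closure ContinuousLinearMap.norm_id_le
    (fun _ hx _ hy => mul_mem_thermalOperations hx hy)
    (fun N => (isThermal_exp_kronecker_one hHB (hBskew N)
      (hHH0.smul_left _)).mem_thermalOperations T)
    (fun N => randomSignChannel_mem hHB hAskew hAcomm T N) hunit hsign

end Main

end ThermalOps

open ThermalOps in
theorem mainTheorem1 (n m : ℕ) (hm : 1 ≤ m) (T : ℝ≥0∞) (hT : 0 < T)
    (H0 : Mat n) (hH0 : H0.IsHermitian)
    (HB : Mat m) (hHB : HB.IsHermitian)
    (Htot : Mat₂ n m) (hHtot : Htot.IsHermitian)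
    (hcomm : Commute Htot (freeHamiltonian H0 HB))
    (E : Fin m → ℝ) (g : OrthonormalBasis (Fin m) ℂ (EuclideanSpace ℂ (Fin m)))
    (hEg : IsSpectralDecomposition HB E g)
    (H : Mat n) (hH : H.IsHermitian) (hHH0 : Commute H H0) :
    (∃ Φ : ℝ → SuperOp n, IsSolution (markovGenerator T H E g Htot) Φ) ∧
    (∀ Φ : ℝ → SuperOp n, IsSolution (markovGenerator T H E g Htot) Φ →
      IsContinuousSemigroup Φ ∧
      ∀ t : ℝ, 0 ≤ t → Φ t ∈ closure (thermalOperations H0 T)) ∧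
    (∀ Φ Ψ : ℝ → SuperOp n, IsSolution (markovGenerator T H E g Htot) Φ →
      IsSolution (markovGenerator T H E g Htot) Ψ → Set.EqOn Φ Ψ (Set.Ici 0)) ∧
    markovGenerator T H E g Htot ∈ lieWedge (closure (thermalOperations H0 T)) := by
  have hmem : ∀ t : ℝ, 0 ≤ t → NormedSpace.exp (t • markovGenerator T H E g Htot) ∈
      closure (thermalOperations H0 T) := fun t ht =>
    exp_markovGenerator_mem hm T hHB hHtot hcomm hEg hH hHH0 ht
  exact ⟨⟨_, isSolution_exp _⟩,
    fun Φ hΦ => ⟨hΦ.isContinuousSemigroup, fun t ht => hΦ.eq_exp ht ▸ hmem t ht⟩,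
    fun Φ Ψ hΦ hΨ t ht => (hΦ.eq_exp ht).trans (hΨ.eq_exp ht).symm, hmem⟩
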